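/- Let $V$ and $H$ be separable complex Hilbert spaces with $V$ continuously and densely embedded in $H$, let $V'$ be the antidual of $V$, and embed $H\hookrightarrow V'$ by $h\mapsto (h\,|\,\cdot)_H$. Let $T>0$, and for $t\in[0,T]$ let $\mathfrak a(t;\cdot,\cdot):V\times V\to\mathbb C$ be a sesquilinear form such that $t\mapsto\mathfrak a(t;u,v)$ is measurable for all $u,v\in V$ and, for some constants $M,\delta>0$, $$|\mathfrak a(t;u,v)|\le M\|u\|_V\|v\|_V,\qquad \operatorname{Re}\mathfrak a(t;u,u)\ge\delta\|u\|_V^2\qquad(t\in[0,T],\ u,v\in V).$$ Let $\mathcal A(t)\in\mathcal L(V,V')$ be given by $\langle\mathcal A(t)u,v\rangle=\mathfrak a(t;u,v)$; consider it also as an unbounded operator on $V'$ with domain $V$, and let $A(t)$ be its part in $H$, i.e. $D(A(t))=\{u\in V:\mathcal A(t)u\in H\}$, $A(t)u=\mathcal A(t)u$. Let $(e^{-r\mathcal A(t)})_{r\ge0}$ on $V'$ and $(e^{-rA(t)})_{r\ge0}$ on $H$ be the $C_0$-semigroups generated by $-\mathcal A(t)$ and $-A(t)$; these semigroups exist. Let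 $$MR(V,V')=H^1(0,T;V')\cap L^2(0,T;V),$$ whose elements are identified with their continuous representatives on $[0,T]$. Let $f\in L^2(0,T;V')$ and $u_0\in H$. For $u\in MR(V,V')$ consider the identity in $V'$ $$u(t)=e^{-tA(t)}u_0+\int_0^t e^{-(t-s)\mathcal A(t)}f(s)\,ds+\int_0^t e^{-(t-s)\mathcal A(t)}\bigl(\mathcal A(t)-\mathcal A(s)\bigr)u(s)\,ds\quad\text{for all }t\in[0,T],\qquad(*)$$ where both integrals exist as Bochner integrals in $V'$ for every $u\in MR(V,V')$ and $t\in[0,T]$. (1) If $u\in MR(V,V')$ is the solution of $\dot u(t)+\mathcal A(t)u(t)=f(t)$ for a.e. $t\in(0,T)$, $u(0)=u_0$, then $u$ satisfies $(*)$. (2) If in addition $t\mapsto\mathcal A(t)\in\mathcal L(V,V')$ is Dini-continuous, i.e. there is a function $\omega$ with $\omega(r)\to0$ as $r\downarrow0$, $\|\mathcal A(t)-\mathcal A(s)\|_{\mathcal L(V,V')}\le\omega(|t-s|)$ for all $s,t\in[0,T]$, and $r\mapsto\omega(r)/r$ in $L^1(0,T)$, then any two elements of $MR(V,V')$ satisfying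 $(*)$ coincide; in particular the solution in (1) is the only element of $MR(V,V')$ satisfying $(*)$. -/

import Mathlib

open Set Filter Topology MeasureTheory
open scoped ContDiff

namespace NonAutonomousForms

section Embeddings

/-- The antidual `V'` of a complex Hilbert space `V`: continuous antilinear functionals. -/
abbrev AntiDual (V : Type*) [NormedAddCommGroup V] [InnerProductSpace ℂ V] : Type _ :=
  V →L⋆[ℂ] ℂ

variable {V H : Type*} [NormedAddCommGroup V] [InnerProductSpace ℂ V]
  [NormedAddCommGroup H] [InnerProductSpace ℂ H]

/-- The embedding `H → V'` attached to `j : V → H`; it sends `h` to `v ↦ (h | j v)_H`, the scalar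
product being linear in `h` and antilinear in `v` (Mathlib's `inner` is antilinear in its first
argument, see `embH_apply`). -/
noncomputable def embH (j : V →L[ℂ] H) : H →L[ℂ] AntiDual V :=
  ((ContinuousLinearMap.compSL V H ℂ (RingHom.id ℂ) (starRingEnd ℂ)).flip j).comp
    (innerSLFlip ℂ)

theorem embH_apply (j : V →L[ℂ] H) (h : H) (v : V) : embH j h v = inner ℂ (j v) h := rfl

/-- The embedding `V → H → V'`. -/
noncomputable def embV (j : V →L[ℂ] H) : V →L[ℂ] AntiDual V :=
  (embH j).comp j

/-- The graph, in `V' × V'`, of the operator `𝒜` on `V'` with domain (the image of) `V` which is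
associated with a bounded sesquilinear form. The form `𝔞` is given in curried form as an element
`A` of `L(V, V')`, that is `⟨𝒜 u, v⟩ = 𝔞(u, v) = A u v`. -/
noncomputable def opDual (j : V →L[ℂ] H) (A : V →L[ℂ] AntiDual V) :
    Submodule ℂ (AntiDual V × AntiDual V) :=
  LinearMap.range ((embV j).prod A : V →L[ℂ] AntiDual V × AntiDual V).toLinearMap

theorem mem_opDual (j : V →L[ℂ] H) (A : V →L[ℂ] AntiDual V) (x y : AntiDual V) :
    (x, y) ∈ opDual j A ↔ ∃ v : V, embV j v = x ∧ A v = y := by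
  simp [opDual, LinearMap.mem_range]

/-- The graph, in `H × H`, of the part of `𝒜` in `H`. -/
noncomputable def opPart (j : V →L[ℂ] H) (A : V →L[ℂ] AntiDual V) : Submodule ℂ (H × H) :=
  (opDual j A).comap ((embH j).prodMap (embH j)).toLinearMap

theorem mem_opPart (j : V →L[ℂ] H) (A : V →L[ℂ] AntiDual V) (x y : H) :
    (x, y) ∈ opPart j A ↔ ∃ v : V, embV j v = embH j x ∧ A v = embH j y :=
  mem_opDual j A (embH j x) (embH j y)

end Embeddings

section Semigroups

variable {X : Type*} [NormedAddCommGroup X] [NormedSpace ℂ X]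

/-- `S` (restricted to `t ≥ 0`) is the `C₀`-semigroup on `X` whose generator is `-B`, where the
unbounded operator `B` is given by its graph: the domain of `B` consists of the `x` for which
`(x - S t x) / t` converges as `t → 0+`, and the limit is `B x`. -/
structure IsSemigroupGeneratedByNeg (B : Submodule ℂ (X × X)) (S : ℝ → X →L[ℂ] X) : Prop where
  map_zero : S 0 = ContinuousLinearMap.id ℂ X
  map_add : ∀ s t : ℝ, 0 ≤ s → 0 ≤ t → S (s + t) = (S s).comp (S t)
  tendsto_zero : ∀ x : X, Tendsto (fun t : ℝ => S t x) (𝓝[>] 0) (𝓝 x)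
  generator : ∀ x y : X, (x, y) ∈ B ↔
    Tendsto (fun t : ℝ => ((t : ℂ)⁻¹) • (x - S t x)) (𝓝[>] 0) (𝓝 y)

open Classical in
/-- The semigroup `e^{-tB}`, `t ≥ 0`. A semigroup is determined on `t ≥ 0` by its generator, so
the choice is immaterial; the value is `0` if `-B` does not generate a `C₀`-semigroup. -/
noncomputable def expNeg (B : Submodule ℂ (X × X)) : ℝ → X →L[ℂ] X :=
  if h : ∃ S : ℝ → X →L[ℂ] X, IsSemigroupGeneratedByNeg B S then h.choose else 0

end Semigroups

section FunctionSpaces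

variable {X : Type*} [NormedAddCommGroup X] [NormedSpace ℂ X]

/-- `g ∈ L²(0,T;X)`. -/
def MemL2 (T : ℝ) (g : ℝ → X) : Prop :=
  MemLp g 2 (volume.restrict (Ioo 0 T))

/-- `g'` is the weak derivative of `g` on `(0,T)`. -/
def IsWeakDeriv (T : ℝ) (g g' : ℝ → X) : Prop :=
  ∀ φ : ℝ → ℝ, ContDiff ℝ ∞ φ → HasCompactSupport φ → tsupport φ ⊆ Ioo 0 T →
    ∫ t in Ioo 0 T, (deriv φ t) • g t = - ∫ t in Ioo 0 T, (φ t) • g' t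

/-- `g ∈ H¹(0,T;X)`. -/
def MemH1 (T : ℝ) (g : ℝ → X) : Prop :=
  MemL2 T g ∧ ∃ g' : ℝ → X, MemL2 T g' ∧ IsWeakDeriv T g g'

/-- `G` is the representative of (the class modulo null sets of) `g` that is continuous on
`[0,T]`. -/
def IsContRep (T : ℝ) (g G : ℝ → X) : Prop :=
  ContinuousOn G (Icc 0 T) ∧ ∀ᵐ t ∂(volume.restrict (Ioo 0 T)), G t = g t

/-- `A` is Dini-continuous on `[0,T]`: it admits a modulus of continuity `w` such that
`t ↦ w t / t` is in `L¹(0,T)`. -/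
def IsDiniContinuous (T : ℝ) (A : ℝ → X) : Prop :=
  ∃ w : ℝ → ℝ, Tendsto w (𝓝[>] 0) (𝓝 0) ∧
    (∀ t ∈ Icc 0 T, ∀ s ∈ Icc 0 T, ‖A t - A s‖ ≤ w |t - s|) ∧
    IntegrableOn (fun t => w t / t) (Ioo 0 T)

end FunctionSpaces

section CauchyProblem

variable {V H : Type*} [NormedAddCommGroup V] [InnerProductSpace ℂ V]
  [NormedAddCommGroup H] [InnerProductSpace ℂ H]

/-- `u ∈ MR(V,V') = H¹(0,T;V') ∩ L²(0,T;V)`. -/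
def MemMR (j : V →L[ℂ] H) (T : ℝ) (u : ℝ → V) : Prop :=
  MemL2 T u ∧ MemH1 T (fun t => embV j (u t))

/-- `u ∈ MR(V,V')` is a solution of `u' + 𝒜(t) u = f` a.e. on `(0,T)`, `u(0) = u₀`. The value
`u(0)` is that of the continuous representative of `u`. -/
def IsSolution (j : V →L[ℂ] H) (T : ℝ) (A : ℝ → V →L[ℂ] AntiDual V) (f : ℝ → AntiDual V)
    (u₀ : H) (u : ℝ → V) : Prop :=
  MemMR j T u ∧
  (∃ u' : ℝ → AntiDual V, MemL2 T u' ∧ IsWeakDeriv T (fun t => embV j (u t)) u' ∧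
    ∀ᵐ t ∂(volume.restrict (Ioo 0 T)), u' t + A t (u t) = f t) ∧
  ∃ U : ℝ → AntiDual V, IsContRep T (fun t => embV j (u t)) U ∧ U 0 = embH j u₀

/-- The representation formula
`u(t) = e^{-tA(t)} u₀ + ∫₀ᵗ e^{-(t-s)𝒜(t)} f(s) ds + ∫₀ᵗ e^{-(t-s)𝒜(t)} (𝒜(t) - 𝒜(s)) u(s) ds`
for all `t ∈ [0,T]`, an identity in `V'` (into which `H` is embedded) for the continuous
representative of `u`; the integrals are Bochner integrals in `V'`. -/
def SatisfiesFormula (j : V →L[ℂ] H) (T : ℝ) (A : ℝ → V →L[ℂ] AntiDual V)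
    (f : ℝ → AntiDual V) (u₀ : H) (u : ℝ → V) : Prop :=
  ∃ U : ℝ → AntiDual V, IsContRep T (fun t => embV j (u t)) U ∧
    ∀ t ∈ Icc 0 T,
      U t = embH j (expNeg (opPart j (A t)) t u₀)
        + (∫ s in (0 : ℝ)..t, expNeg (opDual j (A t)) (t - s) (f s))
        + ∫ s in (0 : ℝ)..t, expNeg (opDual j (A t)) (t - s) ((A t - A s) (u s))

end CauchyProblem

end NonAutonomousForms

open NonAutonomousForms

/-! Fix `t` and freeze the operator. The equation reads `u' + 𝒜(t)u = f + (𝒜(t) - 𝒜(s))u` at time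
`s`, so (1) is Duhamel's formula for the single semigroup `e^{-r𝒜(t)}` on `V'`, evaluated at time
`t`. Duhamel's formula (`duhamel`) is obtained after applying the bounded injective inverse `R` of
the generator: `s ↦ S(t-s)R` is strongly differentiable with derivative `S(t-s)`, so integration by
parts (`integral_clm_apply_by_parts`, a Fubini argument) applies, and `R` is cancelled at the end.
The weak derivative enters through the du Bois-Reymond lemma. The term with `u₀` moves from `H` to
`V'` because the two semigroups are intertwined by the embedding.

For (2), the data cancel in the difference `d` of two elements satisfying the formula, leaving `d(t)
= ∫₀ᵗ e^{-(t-s)𝒜(t)}(𝒜(t) - 𝒜(s))d(s) ds`. Analyticity gives `‖e^{-r𝒜(t)}‖ ≤ K/r` from `V'` to `V`,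
with `K` depending only on the form constants. Hence `‖d‖_V` is dominated by its convolution with `K
ω(r)/r`, which is integrable by the Dini condition. An exponential weight shrinks the mass of this
kernel below one, forcing `d = 0` (`ae_eq_zero_of_le_convolution`).

The semigroups and the bound `K/r` are constructed from resolvent estimates. Lax-Milgram makes `R =
𝒜⁻¹` sectorial (`IsSectorialInverse`). The bounded operators `(R + ε)⁻¹` inherit resolvent bounds
uniform in `ε`, inversion of the Laplace transform along the line `Re z = 1/t` turns these into
bounds on exponentials and their derivatives (`norm_expGroup_le_of_resolvent`), and `ε → 0` yields
the semigroup (`exists_semigroup`). -/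

namespace NonAutonomousForms

/-! ### Integrals of holomorphic functions along vertical lines -/

section VerticalLines

variable {E : Type*} [NormedAddCommGroup E] [NormedSpace ℂ E]

theorem integral_inv_sq_add_sq {x : ℝ} (hx : 0 < x) :
    Integrable (fun y : ℝ => (x ^ 2 + y ^ 2)⁻¹) ∧
      ∫ y : ℝ, (x ^ 2 + y ^ 2)⁻¹ = Real.pi / x := by
  have h : (fun y : ℝ => (x ^ 2 + y ^ 2)⁻¹) =
      fun y : ℝ => (x ^ 2)⁻¹ * (1 + (x⁻¹ * y) ^ 2)⁻¹ := by
    funext y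
    rw [← mul_inv]
    congr 1
    field_simp
  constructor
  · rw [h]
    exact (integrable_inv_one_add_sq.comp_mul_left' (inv_ne_zero hx.ne')).const_mul _
  · rw [h, integral_const_mul, Measure.integral_comp_mul_left (fun y => (1 + y ^ 2)⁻¹),
      integral_univ_inv_one_add_sq, inv_inv, abs_of_pos hx, smul_eq_mul]
    field_simp

theorem sq_norm_add_mul_I (x y : ℝ) : ‖(x + y * Complex.I : ℂ)‖ ^ 2 = x ^ 2 + y ^ 2 := by
  rw [← Complex.normSq_eq_norm_sq, Complex.normSq_add_mul_I]

theorem continuous_comp_vertical {F : ℂ → E} (hF : DifferentiableOn ℂ F {z | 0 < z.re}) {x : ℝ}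
    (hx : 0 < x) : Continuous fun y : ℝ => F (x + y * Complex.I) := by
  refine hF.continuousOn.comp_continuous (by fun_prop) fun y => ?_
  simpa using hx

theorem integrable_vertical {F : ℂ → E} (hF : DifferentiableOn ℂ F {z | 0 < z.re}) {x c : ℝ}
    (hx : 0 < x) (hb : ∀ z : ℂ, z.re = x → ‖F z‖ ≤ c / ‖z‖ ^ 2) :
    Integrable fun y : ℝ => F (x + y * Complex.I) := by
  refine (((integral_inv_sq_add_sq hx).1).const_mul c).mono'
    (continuous_comp_vertical hF hx).aestronglyMeasurable (ae_of_all _ fun y => ?_)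
  have := hb (x + y * Complex.I) (by simp)
  rwa [sq_norm_add_mul_I, div_eq_mul_inv] at this

theorem norm_integral_vertical_le {F : ℂ → E} {x c : ℝ}
    (hx : 0 < x) (hb : ∀ z : ℂ, z.re = x → ‖F z‖ ≤ c / ‖z‖ ^ 2) :
    ‖∫ y : ℝ, F (x + y * Complex.I)‖ ≤ c * (Real.pi / x) := by
  rw [← (integral_inv_sq_add_sq hx).2, ← integral_const_mul]
  refine norm_integral_le_of_norm_le (((integral_inv_sq_add_sq hx).1).const_mul c)
    (ae_of_all _ fun y => ?_)
  have := hb (x + y * Complex.I) (by simp)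
  rwa [sq_norm_add_mul_I, div_eq_mul_inv] at this

/-- Cauchy's theorem on the rectangles of height `2n`: the quadratic decay kills the horizontal
sides as `n → ∞`. -/
theorem integral_vertical_eq {F : ℂ → E} (hF : DifferentiableOn ℂ F {z | 0 < z.re})
    {c x₁ x₂ : ℝ} (hx₁ : 0 < x₁) (hx : x₁ ≤ x₂)
    (hb : ∀ z : ℂ, x₁ ≤ z.re → z.re ≤ x₂ → ‖F z‖ ≤ c / ‖z‖ ^ 2) :
    ∫ y : ℝ, F (x₁ + y * Complex.I) = ∫ y : ℝ, F (x₂ + y * Complex.I) := by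
  have hx₂ : 0 < x₂ := hx₁.trans_le hx
  have hc : 0 ≤ c := by
    have h := (norm_nonneg _).trans (hb x₁ (by simp) (by simpa using hx))
    have h2 : 0 < ‖(x₁ : ℂ)‖ ^ 2 := by
      have : (x₁ : ℂ) ≠ 0 := by exact_mod_cast hx₁.ne'
      positivity
    by_contra hneg
    exact absurd h (not_le.2 (div_neg_of_neg_of_pos (not_le.1 hneg) h2))
  have i₁ := integrable_vertical hF hx₁ fun z hz => hb z hz.ge (hz.le.trans hx)
  have i₂ := integrable_vertical hF hx₂ fun z hz => hb z (hx.trans hz.ge) hz.le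
  have hn : Tendsto (fun n : ℕ => (n : ℝ)) atTop atTop := tendsto_natCast_atTop_atTop
  have hn' : Tendsto (fun n : ℕ => -(n : ℝ)) atTop atBot := tendsto_neg_atTop_atBot.comp hn
  have t₁ := intervalIntegral_tendsto_integral i₁ hn' hn
  have t₂ := intervalIntegral_tendsto_integral i₂ hn' hn
  have horiz : ∀ s : ℝ → ℝ, (∀ r, (s r) ^ 2 = r ^ 2) →
      Tendsto (fun n : ℕ => ∫ x in x₁..x₂, F (x + (s n : ℝ) * Complex.I)) atTop (𝓝 0) := by
    intro s hs
    have hlim : Tendsto (fun n : ℕ => c * ((n : ℝ) ^ 2)⁻¹ * |x₂ - x₁|) atTop (𝓝 0) := by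
      have : Tendsto (fun n : ℕ => ((n : ℝ) ^ 2)⁻¹) atTop (𝓝 0) :=
        tendsto_inv_atTop_zero.comp ((tendsto_pow_atTop two_ne_zero).comp hn)
      simpa using (this.const_mul c).mul_const |x₂ - x₁|
    refine squeeze_zero_norm' ?_ hlim
    filter_upwards [eventually_gt_atTop 0] with n hn0
    refine intervalIntegral.norm_integral_le_of_norm_le_const fun x hx' => ?_
    rw [uIoc_of_le hx] at hx'
    refine (hb _ (by simpa using hx'.1.le) (by simpa using hx'.2)).trans ?_
    rw [sq_norm_add_mul_I, hs, div_eq_mul_inv]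
    have : (0 : ℝ) < n := by exact_mod_cast hn0
    gcongr
    nlinarith [sq_nonneg x]
  have h₁ := horiz (fun r => r) fun r => rfl
  have h₂ := horiz (fun r => -r) fun r => by ring
  have key : ∀ n : ℕ, ((∫ x in x₁..x₂, F (x + ((-(n : ℝ) : ℝ) : ℂ) * Complex.I)) -
      ∫ x in x₁..x₂, F (x + ((n : ℝ) : ℂ) * Complex.I)) +
      Complex.I • (∫ y in (-(n : ℝ))..n, F (x₂ + y * Complex.I)) -
      Complex.I • (∫ y in (-(n : ℝ))..n, F (x₁ + y * Complex.I)) = 0 := by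
    intro n
    have := Complex.integral_boundary_rect_eq_zero_of_differentiableOn F
      (⟨x₁, -n⟩ : ℂ) (⟨x₂, n⟩ : ℂ) (hF.mono ?_)
    · simpa using this
    · intro z hz
      have := hz.1
      simp only [mem_preimage, uIcc_of_le hx] at this
      exact hx₁.trans_le this.1
  have lim := ((h₂.sub h₁).add (t₂.const_smul Complex.I)).sub (t₁.const_smul Complex.I)
  have h0 := tendsto_nhds_unique (lim.congr key) tendsto_const_nhds
  simp only [sub_zero, zero_add] at h0
  have := sub_eq_zero.1 h0
  exact (smul_right_injective E Complex.I_ne_zero this).symm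

end VerticalLines

/-! ### Exponential bounds from resolvent bounds -/

section LaplaceInversion

variable {𝔸 : Type*} [NormedRing 𝔸] [NormedAlgebra ℂ 𝔸]

/-- The uniformly continuous group `t ↦ e^{ta}`. -/
noncomputable def expGroup (a : 𝔸) (t : ℝ) : 𝔸 := NormedSpace.exp ((t : ℂ) • a)

theorem expGroup_zero (a : 𝔸) : expGroup a 0 = 1 := by simp [expGroup]

theorem commute_expGroup {a b : 𝔸} (h : Commute a b) (t : ℝ) : Commute (expGroup a t) b :=
  (h.smul_left _).exp_left

theorem mul_resolvent_cancel {a : 𝔸} {z : ℂ} (hz : z ∈ resolventSet ℂ a) :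
    resolvent a z * (algebraMap ℂ 𝔸 z - a) = 1 :=
  Ring.inverse_mul_cancel _ hz

/-- The cube decays one power faster than integrability requires; the spare power is traded for the
factor `1 / x₁`. -/
theorem norm_pow_three_resolvent_le {a : 𝔸} {C x₁ : ℝ} (hx₁ : 0 < x₁)
    (hC : ∀ z : ℂ, 0 < z.re → ‖resolvent a z‖ ≤ C / ‖z‖) {z : ℂ} (hz : x₁ ≤ z.re) :
    ‖resolvent a z ^ 3‖ ≤ C ^ 3 / x₁ / ‖z‖ ^ 2 := by
  have hz0 : 0 < z.re := hx₁.trans_le hz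
  have hzx : x₁ ≤ ‖z‖ := hz.trans (Complex.re_le_norm z)
  have hzp : 0 < ‖z‖ := hx₁.trans_le hzx
  have h0 := (norm_nonneg _).trans (hC z hz0)
  have hC0 : 0 ≤ C := by
    by_contra hneg
    exact absurd h0 (not_le.2 (div_neg_of_neg_of_pos (not_le.1 hneg) hzp))
  calc ‖resolvent a z ^ 3‖ ≤ ‖resolvent a z‖ ^ 3 := norm_pow_le' _ (by norm_num)
    _ ≤ (C / ‖z‖) ^ 3 := by gcongr; exact hC z hz0
    _ = C ^ 3 / ‖z‖ / ‖z‖ ^ 2 := by field_simp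
    _ ≤ _ := by gcongr

variable [CompleteSpace 𝔸]

theorem hasDerivAt_expGroup (a : 𝔸) (t : ℝ) :
    HasDerivAt (expGroup a) (expGroup a t * a) t := by
  simpa using! (hasDerivAt_exp_smul_const (𝕂 := ℂ) a (t : ℂ)).scomp t
    Complex.ofRealCLM.hasDerivAt

theorem hasDerivAt_expGroup' (a : 𝔸) (t : ℝ) :
    HasDerivAt (expGroup a) (a * expGroup a t) t := by
  simpa using! (hasDerivAt_exp_smul_const' (𝕂 := ℂ) a (t : ℂ)).scomp t
    Complex.ofRealCLM.hasDerivAt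

theorem continuous_expGroup (a : 𝔸) : Continuous (expGroup a) :=
  continuous_iff_continuousAt.2 fun t => (hasDerivAt_expGroup a t).continuousAt

theorem expGroup_add (a : 𝔸) (s t : ℝ) : expGroup a (s + t) = expGroup a s * expGroup a t := by
  let _ : NormedAlgebra ℚ 𝔸 := NormedAlgebra.restrictScalars ℚ ℂ 𝔸
  unfold expGroup
  rw [← NormedSpace.exp_add_of_commute, Complex.ofReal_add, add_smul]
  exact ((Commute.refl a).smul_left _).smul_right _

theorem norm_expGroup_le (a : 𝔸) {t : ℝ} (ht : 0 ≤ t) :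
    ‖expGroup a t‖ ≤ ‖(1 : 𝔸)‖ * Real.exp (‖a‖ * t) := by
  have h := norm_le_gronwallBound_of_norm_deriv_right_le (f := expGroup a)
    (f' := fun s => a * expGroup a s) (δ := ‖(1 : 𝔸)‖) (K := ‖a‖) (ε := 0) (a := 0) (b := t)
    (continuous_expGroup a).continuousOn
    (fun s _ => (hasDerivAt_expGroup' a s).hasDerivWithinAt)
    (by rw [expGroup_zero]) (fun s _ => by simpa using norm_mul_le a (expGroup a s)) t
    ⟨ht, le_rfl⟩
  simpa [gronwallBound_ε0] using h

theorem norm_smul_expGroup_le (a : 𝔸) {z : ℂ} {x : ℝ} (hz : z.re = ‖a‖ + x) {t : ℝ} (ht : 0 ≤ t) :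
    ‖Complex.exp (-z * t) • expGroup a t‖ ≤ ‖(1 : 𝔸)‖ * Real.exp (-(x * t)) := by
  rw [norm_smul, Complex.norm_exp]
  calc Real.exp (-z * t).re * ‖expGroup a t‖
      ≤ Real.exp (-z * t).re * (‖(1 : 𝔸)‖ * Real.exp (‖a‖ * t)) := by
        gcongr; exact norm_expGroup_le a ht
    _ = ‖(1 : 𝔸)‖ * (Real.exp (-z * t).re * Real.exp (‖a‖ * t)) := by ring
    _ = _ := by
        rw [← Real.exp_add]
        congr 2
        simp [Complex.mul_re, hz]
        ring

theorem tendsto_pow_smul_expGroup (a : 𝔸) {z : ℂ} (hz : z.re = ‖a‖ + 1) (n : ℕ) :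
    Tendsto (fun t : ℝ => (t : ℂ) ^ n • Complex.exp (-z * t) • expGroup a t) atTop (𝓝 0) := by
  have h := (Real.tendsto_pow_mul_exp_neg_atTop_nhds_zero n).const_mul ‖(1 : 𝔸)‖
  rw [mul_zero] at h
  refine squeeze_zero_norm' ?_ h
  filter_upwards [eventually_ge_atTop 0] with t ht
  rw [norm_smul, norm_pow, Complex.norm_real, Real.norm_of_nonneg ht]
  calc t ^ n * ‖Complex.exp (-z * t) • expGroup a t‖
      ≤ t ^ n * (‖(1 : 𝔸)‖ * Real.exp (-(1 * t))) := by
        gcongr; exact norm_smul_expGroup_le a hz ht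
    _ = _ := by rw [one_mul]; ring

theorem integrableOn_sq_smul_expGroup (a : 𝔸) {z : ℂ} (hz : z.re = ‖a‖ + 1) :
    IntegrableOn (fun t : ℝ => (t : ℂ) ^ 2 • Complex.exp (-z * t) • expGroup a t) (Ioi 0) := by
  have h := (Real.GammaIntegral_convergent (s := 3) (by norm_num)).const_mul ‖(1 : 𝔸)‖
  refine h.mono' ?_ ?_
  · have := continuous_expGroup a
    exact Continuous.aestronglyMeasurable (by fun_prop)
  · refine (ae_restrict_iff' measurableSet_Ioi).2 (ae_of_all _ fun t ht => ?_)
    have ht : (0 : ℝ) < t := ht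
    rw [norm_smul, norm_pow, Complex.norm_real, Real.norm_of_nonneg ht.le]
    calc t ^ 2 * ‖Complex.exp (-z * t) • expGroup a t‖
        ≤ t ^ 2 * (‖(1 : 𝔸)‖ * Real.exp (-(1 * t))) := by
          gcongr; exact norm_smul_expGroup_le a hz ht.le
      _ = _ := by
          rw [one_mul, show (3 : ℝ) - 1 = (2 : ℕ) by norm_num, Real.rpow_natCast]; ring

theorem laplace_sq_expGroup (a : 𝔸) {z : ℂ} (hz : z.re = ‖a‖ + 1) (hr : z ∈ resolventSet ℂ a) :
    ∫ t in Ioi (0 : ℝ), (t : ℂ) ^ 2 • Complex.exp (-z * t) • expGroup a t =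
      (2 : ℂ) • resolvent a z ^ 3 := by
  set r := resolvent a z with hr_def
  have hrz : r * a = z • r - 1 := by
    have := mul_resolvent_cancel hr
    rw [mul_sub, Algebra.algebraMap_eq_smul_one, mul_smul_comm, mul_one] at this
    rw [← this]; abel
  let e : ℝ → 𝔸 := fun t => Complex.exp (-z * t) • expGroup a t
  have he : ∀ t, HasDerivAt e (-z • e t + a * e t) t := by
    intro t
    have h1 : HasDerivAt (fun t : ℝ => Complex.exp (-z * t)) (Complex.exp (-z * t) * -z) t := by
      have := ((hasDerivAt_id (t : ℂ)).const_mul (-z)).cexp.comp_ofReal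
      simpa using this
    have := h1.smul (hasDerivAt_expGroup' a t)
    convert! this using 1
    simp only [e, mul_smul_comm]
    rw [add_comm, mul_comm _ (-z), mul_smul]
  have hpow : ∀ n : ℕ, ∀ t : ℝ,
      HasDerivAt (fun t : ℝ => (t : ℂ) ^ n) ((n : ℂ) * (t : ℂ) ^ (n - 1)) t := fun n t =>
    (hasDerivAt_pow n (t : ℂ)).comp_ofReal
  -- Primitive obtained by integrating by parts twice, with `r * a = z • r - 1`; only its last term
  -- survives at `0` and gives `2 r³`.
  let G : ℝ → 𝔸 := fun t => -(r * ((t : ℂ) ^ 2 • e t) + (2 : ℂ) • (r ^ 2 * ((t : ℂ) ^ 1 • e t))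
    + (2 : ℂ) • (r ^ 3 * ((t : ℂ) ^ 0 • e t)))
  have hG : ∀ t : ℝ, HasDerivAt G ((t : ℂ) ^ 2 • e t) t := by
    intro t
    have d := fun n => ((hpow n t).smul (he t))
    have := ((((d 2).const_mul r).add (((d 1).const_mul (r ^ 2)).const_smul (2 : ℂ))).add
      (((d 0).const_mul (r ^ 3)).const_smul (2 : ℂ))).neg
    convert! this using 1
    have h2 : r ^ 2 * a = z • r ^ 2 - r := by
      rw [pow_two, mul_assoc, hrz, mul_sub, mul_one, mul_smul_comm]
    have h3 : r ^ 3 * a = z • r ^ 3 - r ^ 2 := by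
      rw [pow_succ r 2, mul_assoc, hrz, mul_sub, mul_one, mul_smul_comm]
    simp only [mul_add, smul_add, mul_smul_comm, ← mul_assoc, hrz, h2, h3, sub_mul, smul_mul_assoc,
      one_mul, neg_smul, smul_neg, smul_sub, smul_smul]
    simp only [pow_zero, pow_one, Nat.cast_ofNat, Nat.cast_one, Nat.cast_zero, mul_one,
      one_mul, Nat.add_one_sub_one, Nat.sub_self, mul_neg, smul_neg, mul_smul_comm]
    module
  have hlim : Tendsto G atTop (𝓝 0) := by
    have l := fun n => tendsto_pow_smul_expGroup a hz n
    have := (((l 2).const_mul r).add (((l 1).const_mul (r ^ 2)).const_smul (2 : ℂ))).add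
      (((l 0).const_mul (r ^ 3)).const_smul (2 : ℂ))
    simpa [G, e] using this.neg
  rw [integral_Ioi_of_hasDerivAt_of_tendsto' (fun t _ => hG t)
    (integrableOn_sq_smul_expGroup a hz) hlim]
  simp [G, e, expGroup_zero]

theorem differentiableOn_resolvent {a : 𝔸} (ha : ∀ z : ℂ, 0 < z.re → z ∈ resolventSet ℂ a) :
    DifferentiableOn ℂ (resolvent a) {z : ℂ | 0 < z.re} := fun z hz =>
  (spectrum.hasDerivAt_resolvent_const_left (ha z hz)).differentiableAt.differentiableWithinAt

theorem differentiableOn_exp_smul_resolvent {a : 𝔸}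
    (ha : ∀ z : ℂ, 0 < z.re → z ∈ resolventSet ℂ a) (b : 𝔸) (t : ℝ) :
    DifferentiableOn ℂ (fun z => Complex.exp (z * t) • (b * resolvent a z ^ 3)) {z : ℂ | 0 < z.re} := by
  have := differentiableOn_resolvent ha
  have h : DifferentiableOn ℂ (fun z : ℂ => Complex.exp (z * t)) {z : ℂ | 0 < z.re} :=
    Differentiable.differentiableOn (by fun_prop)
  exact h.smul ((this.pow 3).const_mul b)

/-- Inversion of the Laplace transform of `t ↦ t² e^{ta}` along a vertical line. -/
theorem sq_smul_expGroup_eq_integral {a : 𝔸} {C : ℝ}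
    (ha : ∀ z : ℂ, 0 < z.re → z ∈ resolventSet ℂ a)
    (hC : ∀ z : ℂ, 0 < z.re → ‖resolvent a z‖ ≤ C / ‖z‖) {x t : ℝ} (hx : 0 < x) (ht : 0 < t) :
    ((Real.pi * t ^ 2 : ℝ) : ℂ) • expGroup a t =
      ∫ y : ℝ, Complex.exp ((x + y * Complex.I) * t) • resolvent a (x + y * Complex.I) ^ 3 := by
  -- On this line the Laplace integral converges absolutely, whatever `a` is; Cauchy's theorem then
  -- moves the line to abscissa `x`.
  set σ : ℝ := ‖a‖ + 1 with hσ
  have hσ0 : 0 < σ := by positivity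
  let F : ℂ → 𝔸 := fun z => Complex.exp (z * t) • resolvent a z ^ 3
  have hFd : DifferentiableOn ℂ F {z : ℂ | 0 < z.re} := by
    simpa using differentiableOn_exp_smul_resolvent ha 1 t
  have hFb : ∀ x₁ x₂ : ℝ, 0 < x₁ → ∀ z : ℂ, x₁ ≤ z.re → z.re ≤ x₂ →
      ‖F z‖ ≤ (Real.exp (x₂ * t) * (C ^ 3 / x₁)) / ‖z‖ ^ 2 := by
    intro x₁ x₂ hx₁ z hz₁ hz₂
    rw [norm_smul, Complex.norm_exp, mul_div_assoc]
    have h1 : (z * t).re ≤ x₂ * t := by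
      simp only [Complex.mul_re, Complex.ofReal_re, Complex.ofReal_im, mul_zero, sub_zero]
      gcongr
    exact mul_le_mul (Real.exp_le_exp.2 h1) (norm_pow_three_resolvent_le hx₁ hC hz₁)
      (norm_nonneg _) (Real.exp_pos _).le
  have shift : ∫ y : ℝ, F (x + y * Complex.I) = ∫ y : ℝ, F (σ + y * Complex.I) := by
    rcases le_total x σ with h | h
    · exact integral_vertical_eq hFd hx h (hFb x σ hx)
    · exact (integral_vertical_eq hFd hσ0 h (hFb σ x hσ0)).symm
  change _ = ∫ y : ℝ, F (x + y * Complex.I)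
  rw [shift]
  -- The factor `s²` makes the extension by zero continuous and its transform integrable, so Fourier
  -- inversion holds pointwise.
  let g : ℝ → 𝔸 := fun s => if 0 ≤ s then (s : ℂ) ^ 2 • Complex.exp (-σ * s) • expGroup a s else 0
  have hgc : Continuous g := by
    have := continuous_expGroup a
    refine Continuous.if_le (by fun_prop) (by fun_prop) (by fun_prop) (by fun_prop) ?_
    intro s hs
    simp [← hs]
  have hgi : Integrable g := by
    have : g =ᵐ[volume] indicator (Ioi 0)
        (fun s : ℝ => (s : ℂ) ^ 2 • Complex.exp (-σ * s) • expGroup a s) := by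
      refine ae_of_all _ fun s => ?_
      rcases lt_trichotomy s 0 with h | h | h
      · simp [g, h.not_ge, h.le]
      · simp [g, h]
      · simp [g, h.le, h]
    rw [integrable_congr this, integrable_indicator_iff measurableSet_Ioi]
    exact integrableOn_sq_smul_expGroup a (by simp [hσ])
  have hFg : FourierTransform.fourier g =
      fun w : ℝ => (2 : ℂ) • resolvent a (σ + (2 * Real.pi * w : ℝ) * Complex.I) ^ 3 := by
    funext w
    rw [Real.fourier_real_eq_integral_exp_smul,
      ← laplace_sq_expGroup a (by simp [hσ]) (ha _ (by simpa using hσ0)),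
      ← integral_indicator measurableSet_Ioi]
    congr 1
    funext s
    rcases lt_trichotomy s 0 with h | h | h
    · simp [g, h.not_ge, h.le]
    · simp [g, h]
    · simp only [g, h.le, if_true, mem_Ioi, h, indicator_of_mem, smul_smul]
      congr 1
      rw [mul_left_comm, ← Complex.exp_add]
      congr 2
      push_cast
      ring
  have hint : Integrable fun y : ℝ => resolvent a (σ + y * Complex.I) ^ 3 :=
    integrable_vertical ((differentiableOn_resolvent ha).pow 3) hσ0
      (fun z hz => norm_pow_three_resolvent_le hσ0 hC hz.ge)
  have hpi : (2 * Real.pi) ≠ 0 := by positivity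
  have hFgi : Integrable (FourierTransform.fourier g) := by
    rw [hFg]
    exact (hint.comp_mul_left' hpi).smul (2 : ℂ)
  have hinv := congrFun (hgc.fourierInv_fourier_eq hgi hFgi) t
  rw [Real.fourierInv_eq', hFg] at hinv
  have h3 : ∫ v : ℝ, Complex.exp (↑(2 * Real.pi * inner ℝ v t) * Complex.I) •
      (fun w : ℝ => (2 : ℂ) • resolvent a (σ + (2 * Real.pi * w : ℝ) * Complex.I) ^ 3) v =
      (2 : ℂ) • |(2 * Real.pi)⁻¹| • ∫ y : ℝ, Complex.exp ((y * t : ℝ) * Complex.I) •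
        resolvent a (σ + y * Complex.I) ^ 3 := by
    rw [← Measure.integral_comp_mul_left (fun y : ℝ => Complex.exp ((y * t : ℝ) * Complex.I) •
        resolvent a (σ + y * Complex.I) ^ 3), ← integral_smul]
    congr 1
    funext v
    simp only
    rw [smul_comm]
    congr 4
    simp [mul_comm, mul_assoc, mul_left_comm]
  have h4 : ∫ y : ℝ, F (σ + y * Complex.I) = Complex.exp (σ * t) •
      ∫ y : ℝ, Complex.exp ((y * t : ℝ) * Complex.I) • resolvent a (σ + y * Complex.I) ^ 3 := by
    rw [← integral_smul]
    congr 1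
    funext y
    simp only [F, smul_smul, ← Complex.exp_add]
    congr 2
    push_cast
    ring
  rw [h3] at hinv
  rw [h4]
  set I₀ := ∫ y : ℝ, Complex.exp ((y * t : ℝ) * Complex.I) • resolvent a (σ + y * Complex.I) ^ 3
  have hpos : 0 < (2 * Real.pi)⁻¹ := by positivity
  have h5 : (2 : ℂ) • |(2 * Real.pi)⁻¹| • I₀ = ((Real.pi⁻¹ : ℝ) : ℂ) • I₀ := by
    rw [abs_of_pos hpos, ← Complex.coe_smul, smul_smul]
    congr 1
    push_cast
    field_simp
  rw [h5] at hinv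
  have h6 : I₀ = (Real.pi : ℂ) • g t := by
    rw [← hinv, smul_smul]
    have : (Real.pi : ℂ) ≠ 0 := by exact_mod_cast Real.pi_ne_zero
    simp [this]
  rw [h6]
  simp only [g, ht.le, if_true, smul_smul]
  congr 1
  have : Complex.exp (σ * t) * Complex.exp (-σ * t) = 1 := by
    rw [← Complex.exp_add]; simp
  push_cast
  linear_combination (-(Real.pi : ℂ) * t ^ 2) * this

/-- On the line `Re z = 1/t` one has `|e^{zt}| = e` and `∫ dy/|z|² = πt`; division by `πt²` leaves
`1/t`. The norm of `a` never enters. -/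
theorem norm_mul_expGroup_le {a : 𝔸} {C : ℝ}
    (ha : ∀ z : ℂ, 0 < z.re → z ∈ resolventSet ℂ a)
    (hC : ∀ z : ℂ, 0 < z.re → ‖resolvent a z‖ ≤ C / ‖z‖) {t : ℝ} (ht : 0 < t) {b : 𝔸} {D : ℝ}
    (hD : ∀ z : ℂ, z.re = t⁻¹ → ‖b * resolvent a z ^ 3‖ ≤ D / ‖z‖ ^ 2) :
    ‖b * expGroup a t‖ ≤ Real.exp 1 * D / t := by
  have hx : 0 < t⁻¹ := inv_pos.2 ht
  have h := congrArg (b * ·) (sq_smul_expGroup_eq_integral ha hC hx ht)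
  simp only [mul_smul_comm] at h
  have hint : Integrable fun y : ℝ =>
      Complex.exp (((t⁻¹ : ℝ) + y * Complex.I) * t) • resolvent a ((t⁻¹ : ℝ) + y * Complex.I) ^ 3 := by
    have hd := differentiableOn_exp_smul_resolvent ha 1 t
    simp only [one_mul] at hd
    refine integrable_vertical (c := Real.exp 1 * (C ^ 3 / t⁻¹)) hd hx fun z hz => ?_
    rw [norm_smul, Complex.norm_exp, mul_div_assoc]
    have h1 : (z * t).re = 1 := by simp [hz, ht.ne']
    rw [h1]
    gcongr
    exact norm_pow_three_resolvent_le hx hC hz.ge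
  rw [← ContinuousLinearMap.mul_apply' ℂ 𝔸 b, ← ContinuousLinearMap.mul_apply' ℂ 𝔸 b,
    ← ContinuousLinearMap.integral_comp_comm _ hint] at h
  have hb := norm_integral_vertical_le
    (F := fun z => (ContinuousLinearMap.mul ℂ 𝔸 b) (Complex.exp (z * t) • resolvent a z ^ 3))
    (c := Real.exp 1 * D) hx (fun z hz => by
      simp only [ContinuousLinearMap.mul_apply', mul_smul_comm]
      rw [norm_smul, Complex.norm_exp, mul_div_assoc]
      have h1 : (z * t).re = 1 := by simp [hz, ht.ne']
      rw [h1]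
      gcongr
      exact hD z hz)
  rw [← h, norm_smul, Complex.norm_real, Real.norm_of_nonneg (by positivity),
    ContinuousLinearMap.mul_apply'] at hb
  have hpi := Real.pi_pos
  have hpt : 0 < Real.pi * t ^ 2 := by positivity
  rw [← mul_le_mul_iff_right₀ hpt]
  refine hb.trans (le_of_eq ?_)
  field_simp

/-- A resolvent estimate in the right half-plane bounds the exponential, with constants that do not
depend on the norm of the element. -/
theorem norm_expGroup_le_of_resolvent {a : 𝔸} {C C' : ℝ}
    (ha : ∀ z : ℂ, 0 < z.re → z ∈ resolventSet ℂ a)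
    (hC : ∀ z : ℂ, 0 < z.re → ‖resolvent a z‖ ≤ C / ‖z‖)
    (hC' : ∀ z : ℂ, 0 < z.re → ‖a * resolvent a z‖ ≤ C') {t : ℝ} (ht : 0 < t) :
    ‖expGroup a t‖ ≤ Real.exp 1 * C ^ 3 ∧
      ‖a * expGroup a t‖ ≤ Real.exp 1 * (C' * C ^ 2) / t := by
  have hx : 0 < t⁻¹ := inv_pos.2 ht
  constructor
  -- This `D` equals `C³ t`, which cancels the factor `1 / t`.
  · have := norm_mul_expGroup_le ha hC ht (b := 1) (D := C ^ 3 / t⁻¹) fun z hz => by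
      rw [one_mul]; exact norm_pow_three_resolvent_le hx hC hz.ge
    rw [one_mul] at this
    refine this.trans (le_of_eq ?_)
    field_simp
  · refine norm_mul_expGroup_le ha hC ht fun z hz => ?_
    have hz0 : 0 < z.re := hz ▸ hx
    rw [pow_succ', ← mul_assoc]
    calc ‖a * resolvent a z * resolvent a z ^ 2‖
        ≤ ‖a * resolvent a z‖ * ‖resolvent a z‖ ^ 2 :=
          (norm_mul_le _ _).trans (by gcongr; exact norm_pow_le' _ (by norm_num))
      _ ≤ C' * (C / ‖z‖) ^ 2 := by
          have := hC z hz0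
          have h0 := (norm_nonneg _).trans (hC' z hz0)
          gcongr
          exact hC' z hz0
      _ = C' * C ^ 2 / ‖z‖ ^ 2 := by rw [div_pow, mul_div_assoc]

end LaplaceInversion

/-! ### Generation of analytic semigroups -/

section Generation

/-- The uniform bound spreads the Cauchy property from a dense set to all of `X` by a three-epsilon
argument. -/
theorem exists_clm_tendsto_of_denseRange {X Y Z : Type*} [NormedAddCommGroup X] [NormedSpace ℂ X]
    [CompleteSpace X] [NormedAddCommGroup Y] [NormedSpace ℂ Y] [CompleteSpace Y]
    {L : ℕ → X →L[ℂ] Y} {K : ℝ} (hK : ∀ n, ‖L n‖ ≤ K) {P : Z → X} (hP : DenseRange P)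
    (hc : ∀ z, CauchySeq fun n => L n (P z)) :
    ∃ L' : X →L[ℂ] Y, (∀ x, Tendsto (fun n => L n x) atTop (𝓝 (L' x))) ∧ ‖L'‖ ≤ K := by
  have hK0 : 0 ≤ K := (norm_nonneg _).trans (hK 0)
  have hcauchy : ∀ x, CauchySeq fun n => L n x := by
    intro x
    rw [Metric.cauchySeq_iff']
    intro ε hε
    have hd : 0 < ε / (4 * (K + 1)) := by positivity
    obtain ⟨z, hz⟩ := hP.exists_dist_lt x hd
    obtain ⟨N, hN⟩ := Metric.cauchySeq_iff'.1 (hc z) (ε / 2) (by positivity)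
    refine ⟨N, fun n hn => ?_⟩
    have hb : ∀ m, dist (L m x) (L m (P z)) ≤ ε / 4 := by
      intro m
      rw [dist_eq_norm, ← map_sub]
      calc ‖L m (x - P z)‖ ≤ ‖L m‖ * ‖x - P z‖ := (L m).le_opNorm _
        _ ≤ (K + 1) * (ε / (4 * (K + 1))) := by
          have := hK m
          rw [← dist_eq_norm]
          gcongr
          linarith
        _ = ε / 4 := by field_simp
    have h1 := dist_triangle4 (L n x) (L n (P z)) (L N (P z)) (L N x)
    have h2 := hb n
    have h3 := hb N
    rw [dist_comm] at h3
    have h4 := hN n hn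
    linarith
  choose f hf using fun x => cauchySeq_tendsto_of_complete (hcauchy x)
  refine ⟨continuousLinearMapOfTendsto L (tendsto_pi_nhds.2 hf), hf, ?_⟩
  refine ContinuousLinearMap.opNorm_le_bound _ hK0 fun x => ?_
  refine le_of_tendsto (hf x).norm (Eventually.of_forall fun n => ?_)
  exact ((L n).le_opNorm x).trans (by gcongr; exact hK n)

variable {X : Type*} [NormedAddCommGroup X] [NormedSpace ℂ X]

/-- `R` is the inverse of an operator `𝒜` such that `𝒜 (λ + 𝒜)⁻¹ = (1 + λ R)⁻¹` exists and is
bounded by `C` for all `λ` in the closed right half-plane. -/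
def IsSectorialInverse (R : X →L[ℂ] X) (C : ℝ) : Prop :=
  ∀ z : ℂ, 0 ≤ z.re → ∃ J : X →L[ℂ] X, J * (1 + z • R) = 1 ∧ (1 + z • R) * J = 1 ∧ ‖J‖ ≤ C

/-- The bounds satisfied by the approximations `A = (R + ε)⁻¹` of the unbounded inverse of `R`. -/
structure IsApproxInverse (R : X →L[ℂ] X) (C ε : ℝ) (A : X →L[ℂ] X) : Prop where
  pos : 0 < ε
  left_inv : A * (R + (ε : ℂ) • 1) = 1
  right_inv : (R + (ε : ℂ) • 1) * A = 1
  norm_mul_le : ‖A * R‖ ≤ 1 + C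
  mem_resolventSet : ∀ z : ℂ, 0 < z.re → z ∈ resolventSet ℂ (-A)
  norm_resolvent_le : ∀ z : ℂ, 0 < z.re → ‖resolvent (-A) z‖ ≤ (1 + C) / ‖z‖
  norm_mul_resolvent_le : ∀ z : ℂ, 0 < z.re → ‖-A * resolvent (-A) z‖ ≤ 1 + C

theorem norm_one_clm_le : ‖(1 : X →L[ℂ] X)‖ ≤ 1 := ContinuousLinearMap.norm_id_le

namespace IsSectorialInverse

variable {R : X →L[ℂ] X} {C : ℝ}

theorem nonneg (h : IsSectorialInverse R C) : 0 ≤ C := by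
  obtain ⟨J, -, -, hJ⟩ := h 0 le_rfl
  exact (norm_nonneg J).trans hJ

/-- Bounds uniform in `ε` come from `1 + z(R + ε) = (1 + zε)(1 + μR)` with `μ = z/(1 + zε)`: the map
`z ↦ μ` preserves the right half-plane, and `|1 + zε| ≥ 1`. -/
theorem exists_approxInverse (h : IsSectorialInverse R C) {ε : ℝ} (hε : 0 < ε) :
    ∃ A, IsApproxInverse R C ε A := by
  have hε' : (ε : ℂ) ≠ 0 := by exact_mod_cast hε.ne'
  obtain ⟨J, hJ1, hJ2, hJC⟩ := h ((ε⁻¹ : ℝ) : ℂ) (by simpa using hε.le)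
  have hRε : R + (ε : ℂ) • 1 = (ε : ℂ) • (1 + ((ε⁻¹ : ℝ) : ℂ) • R) := by
    rw [smul_add, smul_smul, add_comm]
    simp [hε']
  set A : X →L[ℂ] X := ((ε⁻¹ : ℝ) : ℂ) • J with hA
  have h1 : A * (R + (ε : ℂ) • 1) = 1 := by
    rw [hRε, hA, smul_mul_smul_comm, hJ1]
    simp [hε']
  have h2 : (R + (ε : ℂ) • 1) * A = 1 := by
    rw [hRε, hA, smul_mul_smul_comm, hJ2]
    simp [hε']
  have hres : ∀ z : ℂ, 0 < z.re → ∃ K G : X →L[ℂ] X, ‖K‖ ≤ C ∧ (z • 1 + A) * G = 1 ∧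
      G * (z • 1 + A) = 1 ∧ A * G = K ∧ z • G = 1 - K := by
    intro z hz
    have hre : 1 ≤ (1 + z * ε).re := by
      simp only [Complex.add_re, Complex.one_re, Complex.mul_re, Complex.ofReal_re,
        Complex.ofReal_im, mul_zero, sub_zero]
      nlinarith
    have hnorm : 1 ≤ ‖1 + z * ε‖ := hre.trans (Complex.re_le_norm _)
    have hne : (1 + z * ε) ≠ 0 := norm_pos_iff.1 (zero_lt_one.trans_le hnorm)
    have hμ : 0 ≤ (z / (1 + z * ε)).re := by
      rw [Complex.div_re, ← add_div]
      refine div_nonneg ?_ (Complex.normSq_nonneg _)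
      simp
      nlinarith [mul_nonneg hz.le hε.le, mul_nonneg (sq_nonneg z.re) hε.le,
        mul_nonneg (sq_nonneg z.im) hε.le]
    obtain ⟨J', h1', h2', hC'⟩ := h _ hμ
    have hfac : 1 + z • (R + (ε : ℂ) • 1) =
        (1 + z * ε) • (1 + (z / (1 + z * ε)) • R) := by
      rw [smul_add (1 + z * (ε : ℂ)), smul_smul, mul_div_cancel₀ _ hne]
      module
    set K : X →L[ℂ] X := (1 + z * ε)⁻¹ • J' with hK
    have k1 : K * (1 + z • (R + (ε : ℂ) • 1)) = 1 := by
      rw [hfac, hK, smul_mul_smul_comm, h1', inv_mul_cancel₀ hne, one_smul]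
    have k2 : (1 + z • (R + (ε : ℂ) • 1)) * K = 1 := by
      rw [hfac, hK, smul_mul_smul_comm, h2', mul_inv_cancel₀ hne, one_smul]
    have hcomm : (R + (ε : ℂ) • 1) * K = K * (R + (ε : ℂ) • 1) := by
      have hc : Commute (1 + z • (R + (ε : ℂ) • 1)) (R + (ε : ℂ) • 1) :=
        (Commute.one_left _).add_left ((Commute.refl _).smul_left z)
      calc (R + (ε : ℂ) • 1) * K
          = (K * (1 + z • (R + (ε : ℂ) • 1))) * ((R + (ε : ℂ) • 1) * K) := by rw [k1, one_mul]
        _ = K * ((1 + z • (R + (ε : ℂ) • 1)) * (R + (ε : ℂ) • 1)) * K := by noncomm_ring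
        _ = K * (R + (ε : ℂ) • 1) * ((1 + z • (R + (ε : ℂ) • 1)) * K) := by
          rw [hc.eq]; noncomm_ring
        _ = _ := by rw [k2, mul_one]
    refine ⟨K, (R + (ε : ℂ) • 1) * K, ?_, ?_, ?_, ?_, ?_⟩
    · rw [hK, norm_smul, norm_inv]
      calc ‖1 + z * ε‖⁻¹ * ‖J'‖ ≤ 1 * ‖J'‖ := by gcongr; exact inv_le_one_of_one_le₀ hnorm
        _ ≤ C := by rwa [one_mul]
    · rw [← mul_assoc, add_mul, h1, smul_mul_assoc, one_mul, add_comm, k2]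
    · rw [hcomm, mul_assoc, mul_add, h2, mul_smul_comm, mul_one, add_comm, k1]
    · rw [← mul_assoc, h1, one_mul]
    · rw [add_mul, one_mul, smul_mul_assoc] at k2
      exact eq_sub_of_add_eq' k2
  have hres' : ∀ z : ℂ, 0 < z.re → z ∈ resolventSet ℂ (-A) ∧ ∃ K : X →L[ℂ] X, ‖K‖ ≤ C ∧
      A * resolvent (-A) z = K ∧ z • resolvent (-A) z = 1 - K := by
    intro z hz
    obtain ⟨K, G, hKC, g1, g2, g3, g4⟩ := hres z hz
    let u : (X →L[ℂ] X)ˣ := ⟨z • 1 + A, G, g1, g2⟩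
    have hu : algebraMap ℂ (X →L[ℂ] X) z - -A = u := by
      rw [sub_neg_eq_add, Algebra.algebraMap_eq_smul_one]
    have hG : resolvent (-A) z = G := by
      rw [resolvent, hu, Ring.inverse_unit]
      rfl
    refine ⟨⟨u, hu.symm⟩, K, hKC, ?_, ?_⟩ <;> rw [hG] <;> assumption
  refine ⟨A, hε, h1, h2, ?_, fun z hz => (hres' z hz).1, fun z hz => ?_, fun z hz => ?_⟩
  · have : A * R = 1 - J := by
      rw [mul_add, mul_smul_comm, mul_one] at h1
      rw [eq_sub_iff_add_eq, ← h1, hA, smul_smul]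
      simp [hε']
    rw [this]
    exact (norm_sub_le _ _).trans (add_le_add norm_one_clm_le hJC)
  · obtain ⟨-, K, hKC, -, hG⟩ := hres' z hz
    have hz0 : 0 < ‖z‖ := hz.trans_le (Complex.re_le_norm z)
    rw [le_div_iff₀ hz0, mul_comm, ← norm_smul, hG]
    exact (norm_sub_le _ _).trans (add_le_add norm_one_clm_le hKC)
  · obtain ⟨-, K, hKC, hK, -⟩ := hres' z hz
    rw [neg_mul, norm_neg, hK]
    linarith

end IsSectorialInverse

/-- The bound of the semigroup generated by `-R⁻¹`, see `IsSectorialInverse.exists_semigroup`. -/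
noncomputable def sectorialBound (C : ℝ) : ℝ := Real.exp 1 * (1 + C) ^ 3

namespace IsApproxInverse

variable {R : X →L[ℂ] X} {C ε η : ℝ} {A B : X →L[ℂ] X}

theorem add_nonneg (h : IsApproxInverse R C ε A) : 0 ≤ 1 + C :=
  (norm_nonneg _).trans h.norm_mul_le

theorem commute_of_commute (h : IsApproxInverse R C ε A) {D : X →L[ℂ] X} (hD : Commute R D) :
    Commute A D := by
  have hD' : (R + (ε : ℂ) • 1) * D = D * (R + (ε : ℂ) • 1) :=
    (hD.add_left ((Commute.one_left D).smul_left _)).eq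
  calc A * D = A * (D * (R + (ε : ℂ) • 1)) * A := by
        rw [mul_assoc, mul_assoc, h.right_inv, mul_one]
    _ = D * A := by rw [← hD', ← mul_assoc, h.left_inv, one_mul]

theorem commute_self (h : IsApproxInverse R C ε A) : Commute A R :=
  h.commute_of_commute (Commute.refl R)

theorem commute (h : IsApproxInverse R C ε A) (h' : IsApproxInverse R C η B) : Commute A B :=
  h.commute_of_commute h'.commute_self.symm

variable [CompleteSpace X]

theorem norm_expGroup_le (h : IsApproxInverse R C ε A) (hC : 0 ≤ C) {t : ℝ} (ht : 0 ≤ t) :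
    ‖expGroup (-A) t‖ ≤ sectorialBound C := by
  rcases ht.eq_or_lt with rfl | ht
  · rw [expGroup_zero]
    refine norm_one_clm_le.trans (one_le_mul_of_one_le_of_one_le (Real.one_le_exp zero_le_one) ?_)
    exact one_le_pow₀ (by linarith)
  · exact (norm_expGroup_le_of_resolvent h.mem_resolventSet h.norm_resolvent_le
      h.norm_mul_resolvent_le ht).1

theorem norm_mul_expGroup_le (h : IsApproxInverse R C ε A) {t : ℝ} (ht : 0 < t) :
    ‖A * expGroup (-A) t‖ ≤ sectorialBound C / t := by
  have := (norm_expGroup_le_of_resolvent h.mem_resolventSet h.norm_resolvent_le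
      h.norm_mul_resolvent_le ht).2
  rw [neg_mul, norm_neg] at this
  refine this.trans (le_of_eq ?_)
  rw [sectorialBound]
  ring

theorem sectorialBound_nonneg (hC : 0 ≤ C) : 0 ≤ sectorialBound C := by
  unfold sectorialBound; positivity

/-- The derivative of `s ↦ e^{-sA}R` is `-e^{-sA}AR`, and `AR` is bounded independently of `ε`. -/
theorem norm_expGroup_mul_sub_le (h : IsApproxInverse R C ε A) (hC : 0 ≤ C) {t : ℝ} (ht : 0 ≤ t) :
    ‖expGroup (-A) t * R - R‖ ≤ sectorialBound C * (1 + C) * t := by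
  have := norm_image_sub_le_of_norm_deriv_le_segment' (f := fun s => expGroup (-A) s * R)
    (f' := fun s => expGroup (-A) s * -A * R) (C := sectorialBound C * (1 + C)) (a := 0) (b := t)
    (fun s _ => ((hasDerivAt_expGroup (-A) s).mul_const R).hasDerivWithinAt)
    (fun s hs => by
      rw [mul_assoc, neg_mul, mul_neg, norm_neg]
      exact (_root_.norm_mul_le _ _).trans (mul_le_mul (h.norm_expGroup_le hC hs.1) h.norm_mul_le
        (norm_nonneg _) (sectorialBound_nonneg hC))) t ⟨ht, le_rfl⟩
  simpa [expGroup_zero] using this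

/-- Differentiate `e^{-(t-s)A} e^{-sB}` in `s`. The difference `A - B = (η - ε)AB` appears, and each
of the two factors `R` absorbs one of the unbounded factors `A`, `B`. -/
theorem norm_expGroup_sub_mul_le (h : IsApproxInverse R C ε A) (h' : IsApproxInverse R C η B)
    (hC : 0 ≤ C) {t : ℝ} (ht : 0 ≤ t) :
    ‖(expGroup (-A) t - expGroup (-B) t) * (R * R)‖ ≤
      sectorialBound C ^ 2 * (1 + C) ^ 2 * |ε - η| * t := by
  have hAB : A * R * (B * R) * ((η - ε : ℝ) : ℂ) • 1 = (A - B) * (R * R) := by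
    have e1 : A * ((R + (η : ℂ) • 1) - (R + (ε : ℂ) • 1)) * B = A - B := by
      rw [mul_sub, sub_mul, h.left_inv, one_mul, mul_assoc, h'.right_inv, mul_one]
    have e2 : (R + (η : ℂ) • 1) - (R + (ε : ℂ) • 1) = ((η - ε : ℝ) : ℂ) • (1 : X →L[ℂ] X) := by
      push_cast; module
    rw [← e1, e2]
    have hBR := h'.commute_self.eq
    simp only [mul_smul_comm, smul_mul_assoc, mul_one]
    congr 1
    calc A * R * (B * R) = A * (R * B) * R := by noncomm_ring
      _ = _ := by rw [← hBR]; noncomm_ring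
  have hcomm : ∀ s, Commute A (expGroup (-B) s) := fun s =>
    (commute_expGroup ((h.commute h').symm.neg_left) s).symm
  have hn : ‖(A - B) * (R * R)‖ ≤ (1 + C) ^ 2 * |ε - η| := by
    rw [← hAB, mul_smul_comm, mul_one, norm_smul, Complex.norm_real, Real.norm_eq_abs, abs_sub_comm,
      mul_comm, pow_two]
    gcongr
    exact (_root_.norm_mul_le _ _).trans (mul_le_mul h.norm_mul_le h'.norm_mul_le (norm_nonneg _)
      h.add_nonneg)
  have hd : ∀ s, HasDerivAt (fun s => expGroup (-A) (t - s) * expGroup (-B) s * (R * R))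
      (expGroup (-A) (t - s) * expGroup (-B) s * ((A - B) * (R * R))) s := by
    intro s
    have d1 : HasDerivAt (fun s => expGroup (-A) (t - s)) (expGroup (-A) (t - s) * A) s := by
      have := (hasDerivAt_expGroup (-A) (t - s)).scomp s ((hasDerivAt_id s).const_sub t)
      simpa [Function.comp_def] using this
    have := (d1.mul (hasDerivAt_expGroup (-B) s)).mul_const (R * R)
    convert! this using 1
    rw [mul_assoc (expGroup (-A) (t - s)) A, (hcomm s).eq]
    noncomm_ring
  have := norm_image_sub_le_of_norm_deriv_le_segment'
    (C := sectorialBound C ^ 2 * ((1 + C) ^ 2 * |ε - η|)) (a := 0) (b := t)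
    (fun s _ => (hd s).hasDerivWithinAt)
    (fun s hs => by
      refine (_root_.norm_mul_le _ _).trans ?_
      refine mul_le_mul ((_root_.norm_mul_le _ _).trans ?_) hn (norm_nonneg _)
        (sq_nonneg _)
      rw [pow_two]
      exact mul_le_mul (h.norm_expGroup_le hC (by linarith [hs.2])) (h'.norm_expGroup_le hC hs.1)
        (norm_nonneg _) (sectorialBound_nonneg hC)) t ⟨ht, le_rfl⟩
  simp only [sub_self, expGroup_zero, one_mul, sub_zero, mul_one] at this
  rw [← norm_neg, ← neg_mul, neg_sub, sub_mul]
  refine this.trans (le_of_eq ?_)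
  ring

/-- Since `A(R + ε)x = x`, the orbit of `(R + ε)x` has derivative `-e^{-sA}x`, which is `θ`-close to
`-x`. In the limit `ε → 0` this identifies the generator. -/
theorem norm_approx_generator_le (h : IsApproxInverse R C ε A) {t θ : ℝ} (ht : 0 ≤ t) {x : X}
    (hx : ∀ s ∈ Icc 0 t, ‖expGroup (-A) s x - x‖ ≤ θ) :
    ‖(R x + (ε : ℂ) • x) - expGroup (-A) t (R x + (ε : ℂ) • x) - (t : ℂ) • x‖ ≤ θ * t := by
  have hAx : A (R x + (ε : ℂ) • x) = x := by
    simpa using congrArg (fun L : X →L[ℂ] X => L x) h.left_inv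
  have hd : ∀ s : ℝ, HasDerivAt
      (fun s : ℝ => expGroup (-A) s (R x + (ε : ℂ) • x) + (s : ℂ) • x)
      (-(expGroup (-A) s x - x)) s := by
    intro s
    have d1 := ((ContinuousLinearMap.apply ℂ X (R x + (ε : ℂ) • x)).restrictScalars
      ℝ).hasFDerivAt.comp_hasDerivAt s (hasDerivAt_expGroup (-A) s)
    have d2 : HasDerivAt (fun s : ℝ => (s : ℂ) • x) x s := by
      simpa using! (Complex.ofRealCLM.hasDerivAt (x := s)).smul_const x
    have := d1.add d2
    convert! this using 1
    change -(expGroup (-A) s x - x) = expGroup (-A) s (-(A (R x + (ε : ℂ) • x))) + x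
    rw [hAx, map_neg]
    abel
  have := norm_image_sub_le_of_norm_deriv_le_segment' (C := θ) (a := 0) (b := t)
    (fun s _ => (hd s).hasDerivWithinAt)
    (fun s hs => by rw [norm_neg]; exact hx s ⟨hs.1, hs.2.le⟩) t ⟨ht, le_rfl⟩
  rw [← norm_neg]
  simp only [expGroup_zero, one_apply_eq_self, Complex.ofReal_zero, zero_smul,
    add_zero, sub_zero] at this
  refine le_trans (le_of_eq ?_) this
  congr 1
  abel

end IsApproxInverse

namespace IsSectorialInverse

variable [CompleteSpace X] {R : X →L[ℂ] X} {C : ℝ}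

/-- The approximating semigroups are equicontinuous at `0`, uniformly in the approximation. -/
theorem exists_forall_norm_expGroup_sub_le (h : IsSectorialInverse R C) (hR : DenseRange R) (x : X)
    {θ : ℝ} (hθ : 0 < θ) : ∃ τ > 0, ∀ ε A, IsApproxInverse R C ε A → ∀ s ∈ Icc 0 τ,
      ‖expGroup (-A) s x - x‖ ≤ θ := by
  have hC := h.nonneg
  have hK := IsApproxInverse.sectorialBound_nonneg hC
  set K := sectorialBound C
  -- On the range of `R` the orbits are Lipschitz uniformly in `ε`; the remainder `x - R y` is
  -- controlled by the uniform bound.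
  obtain ⟨y, hy⟩ := hR.exists_dist_lt x (show 0 < θ / (2 * (K + 1)) by positivity)
  refine ⟨θ / (2 * (K * (1 + C) * ‖y‖ + 1)), by positivity, fun ε A hA s hs => ?_⟩
  have e : expGroup (-A) s x - x =
      expGroup (-A) s (x - R y) + (expGroup (-A) s * R - R) y - (x - R y) := by
    simp
  rw [dist_eq_norm] at hy
  have h1 : ‖expGroup (-A) s (x - R y)‖ ≤ K * ‖x - R y‖ :=
    ((expGroup (-A) s).le_opNorm _).trans (by gcongr; exact hA.norm_expGroup_le hC hs.1)
  have h2 : ‖(expGroup (-A) s * R - R) y‖ ≤ K * (1 + C) * s * ‖y‖ :=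
    (ContinuousLinearMap.le_opNorm _ _).trans
      (by gcongr; exact hA.norm_expGroup_mul_sub_le hC hs.1)
  have h3 : (K + 1) * ‖x - R y‖ ≤ θ / 2 := by
    calc (K + 1) * ‖x - R y‖ ≤ (K + 1) * (θ / (2 * (K + 1))) := by gcongr
      _ = θ / 2 := by field_simp
  have h4 : K * (1 + C) * s * ‖y‖ ≤ θ / 2 := by
    have h5 := hs.2
    rw [le_div_iff₀ (by positivity)] at h5
    nlinarith [hs.1]
  rw [e]
  calc _ ≤ ‖expGroup (-A) s (x - R y)‖ + ‖(expGroup (-A) s * R - R) y‖ + ‖x - R y‖ :=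
        (norm_sub_le _ _).trans (by gcongr; exact norm_add_le _ _)
    _ ≤ θ := by linarith

/-- A sectorial operator generates a `C₀`-semigroup; the bounds, including the one expressing
analyticity, only depend on the constant of sectoriality. -/
theorem exists_semigroup (h : IsSectorialInverse R C) (hR : DenseRange R)
    {B : Submodule ℂ (X × X)} (hB : ∀ x y, (x, y) ∈ B ↔ R y = x) :
    ∃ S Q : ℝ → X →L[ℂ] X, IsSemigroupGeneratedByNeg B S ∧
      (∀ t, 0 ≤ t → ‖S t‖ ≤ sectorialBound C) ∧ (∀ t, 0 < t → ∀ x, R (Q t x) = S t x) ∧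
      (∀ t, 0 < t → ‖Q t‖ ≤ sectorialBound C / t) ∧
      ∀ x, StronglyMeasurable fun t => Q t x := by
  have hC := h.nonneg
  have hK := IsApproxInverse.sectorialBound_nonneg hC
  set K := sectorialBound C
  let ε : ℕ → ℝ := fun n => 1 / ((n : ℝ) + 1)
  have hε : ∀ n, 0 < ε n := fun n => by positivity
  have hεlim : Tendsto ε atTop (𝓝 0) := tendsto_one_div_add_atTop_nhds_zero_nat
  have hεlim' : Tendsto (fun n => (ε n : ℂ)) atTop (𝓝 0) := by
    simpa using! (Complex.continuous_ofReal.tendsto 0).comp hεlim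
  choose A hA using fun n => h.exists_approxInverse (hε n)
  -- On the range of `R²` the approximating exponentials differ by a multiple of `|ε n - ε m|`,
  -- hence are Cauchy.
  have hRR : DenseRange fun y => R (R y) := hR.comp hR R.continuous
  have hS : ∀ t, 0 ≤ t → ∃ L : X →L[ℂ] X,
      (∀ x, Tendsto (fun n => expGroup (-A n) t x) atTop (𝓝 (L x))) ∧ ‖L‖ ≤ K := by
    intro t ht
    refine exists_clm_tendsto_of_denseRange (fun n => (hA n).norm_expGroup_le hC ht) hRR fun y => ?_
    have hb : ∀ n m, ‖expGroup (-A n) t (R (R y)) - expGroup (-A m) t (R (R y))‖ ≤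
        K ^ 2 * (1 + C) ^ 2 * t * ‖y‖ * |ε n - ε m| := by
      intro n m
      have := ((expGroup (-A n) t - expGroup (-A m) t) * (R * R)).le_opNorm y
      refine (le_trans (le_of_eq ?_) this).trans ?_
      · simp
      · calc _ ≤ (K ^ 2 * (1 + C) ^ 2 * |ε n - ε m| * t) * ‖y‖ := by
              gcongr; exact (hA n).norm_expGroup_sub_mul_le (hA m) hC ht
          _ = _ := by ring
    rw [cauchySeq_iff_tendsto_dist_atTop_0]
    have hc := cauchySeq_iff_tendsto_dist_atTop_0.1 hεlim.cauchySeq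
    have := hc.const_mul (K ^ 2 * (1 + C) ^ 2 * t * ‖y‖)
    rw [mul_zero] at this
    exact squeeze_zero (fun _ => dist_nonneg) (fun p => by
      rw [dist_eq_norm, Real.dist_eq]; exact hb p.1 p.2) this
  choose! S hSlim hSK using hS
  have hQ : ∀ t, 0 < t → ∃ L : X →L[ℂ] X,
      (∀ x, Tendsto (fun n => (A n * expGroup (-A n) t) x) atTop (𝓝 (L x))) ∧ ‖L‖ ≤ K / t := by
    intro t ht
    refine exists_clm_tendsto_of_denseRange (fun n => (hA n).norm_mul_expGroup_le ht) hR fun y => ?_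
    -- From `A R = 1 - εA`: on the range of `R`, `A e^{-tA}` reduces to `e^{-tA}` up to a term
    -- vanishing with `ε`.
    have e : ∀ n, (A n * expGroup (-A n) t) (R y) =
        expGroup (-A n) t y - (ε n : ℂ) • (A n * expGroup (-A n) t) y := by
      intro n
      have c1 : Commute (A n) (expGroup (-A n) t) :=
        (commute_expGroup ((Commute.refl (A n)).neg_left) t).symm
      have c2 := congrArg (fun L : X →L[ℂ] X => L y) (hA n).left_inv
      simp only [mul_apply_eq_comp, add_apply,
        smul_apply, one_apply_eq_self, map_add, map_smul] at c2
      rw [c1.eq, mul_apply_eq_comp, mul_apply_eq_comp,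
        ← map_smul, ← map_sub, eq_sub_of_add_eq c2]
    have hz : Tendsto (fun n => (ε n : ℂ) • (A n * expGroup (-A n) t) y) atTop (𝓝 0) := by
      have := hεlim.mul_const (K / t * ‖y‖)
      rw [zero_mul] at this
      refine squeeze_zero_norm (fun n => ?_) this
      rw [norm_smul, Complex.norm_real, Real.norm_of_nonneg (hε n).le]
      gcongr
      exact (ContinuousLinearMap.le_opNorm _ _).trans
        (by gcongr; exact (hA n).norm_mul_expGroup_le ht)
    have := (hSlim t ht.le y).sub hz
    simp_rw [e]
    exact this.cauchySeq
  choose! Q' hQlim hQK using hQ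
  -- The value `0` for `t ≤ 0` makes `Q` a pointwise limit of measurable functions on the whole
  -- line.
  let Q : ℝ → X →L[ℂ] X := fun t => if 0 < t then Q' t else 0
  have hQ_pos : ∀ t, 0 < t → Q t = Q' t := fun t ht => if_pos ht
  have hsmall : ∀ x : X, ∀ θ : ℝ, 0 < θ → ∃ τ > 0, ∀ t ∈ Icc 0 τ,
      ‖S t x - x‖ ≤ θ ∧ ‖R x - S t (R x) - (t : ℂ) • x‖ ≤ θ * t := by
    intro x θ hθ
    obtain ⟨τ, hτ, H⟩ := h.exists_forall_norm_expGroup_sub_le hR x hθ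
    refine ⟨τ, hτ, fun t ht => ⟨?_, ?_⟩⟩
    · exact le_of_tendsto ((hSlim t ht.1 x).sub_const x).norm
        (Eventually.of_forall fun n => H _ _ (hA n) t ht)
    · have l1 : Tendsto (fun n => (R x + (ε n : ℂ) • x) -
          (expGroup (-A n) t (R x) + (ε n : ℂ) • expGroup (-A n) t x) - (t : ℂ) • x) atTop
          (𝓝 ((R x + (0 : ℂ) • x) - (S t (R x) + (0 : ℂ) • S t x) - (t : ℂ) • x)) :=
        ((tendsto_const_nhds.add (hεlim'.smul_const x)).sub
          ((hSlim t ht.1 _).add (hεlim'.smul (hSlim t ht.1 x)))).sub_const _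
      rw [zero_smul, zero_smul, add_zero, add_zero] at l1
      refine le_of_tendsto l1.norm (Eventually.of_forall fun n => ?_)
      have := (hA n).norm_approx_generator_le ht.1
        (fun s hs => H _ _ (hA n) s ⟨hs.1, hs.2.trans ht.2⟩)
      simpa using this
  have hcommR : ∀ t, 0 ≤ t → ∀ x, R (S t x) = S t (R x) := by
    intro t ht x
    refine tendsto_nhds_unique ((R.continuous.tendsto _).comp (hSlim t ht x)) ?_
    refine (hSlim t ht (R x)).congr fun n => ?_
    have := (commute_expGroup ((hA n).commute_self.neg_left) t).eq
    exact congrArg (fun L : X →L[ℂ] X => L x) this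
  have h0lim : ∀ x : X, Tendsto (fun t : ℝ => S t x) (𝓝[>] 0) (𝓝 x) := by
    intro x
    rw [Metric.tendsto_nhds]
    intro θ hθ
    obtain ⟨τ, hτ, H⟩ := hsmall x (θ / 2) (by positivity)
    filter_upwards [Ioc_mem_nhdsGT hτ] with t ht
    rw [dist_eq_norm]
    linarith [(H t ⟨ht.1.le, ht.2⟩).1]
  have hgen : ∀ x : X, Tendsto (fun t : ℝ => ((t : ℂ)⁻¹) • (R x - S t (R x))) (𝓝[>] 0) (𝓝 x) := by
    intro x
    rw [Metric.tendsto_nhds]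
    intro θ hθ
    obtain ⟨τ, hτ, H⟩ := hsmall x (θ / 2) (by positivity)
    filter_upwards [Ioc_mem_nhdsGT hτ] with t ht
    have ht0 : (t : ℂ) ≠ 0 := by exact_mod_cast ht.1.ne'
    have e : ((t : ℂ)⁻¹) • (R x - S t (R x)) - x =
        ((t : ℂ)⁻¹) • (R x - S t (R x) - (t : ℂ) • x) := by
      rw [smul_sub _ _ ((t : ℂ) • x), smul_smul, inv_mul_cancel₀ ht0, one_smul]
    rw [dist_eq_norm, e, norm_smul, norm_inv, Complex.norm_real, Real.norm_of_nonneg ht.1.le]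
    have := (H t ⟨ht.1.le, ht.2⟩).2
    calc t⁻¹ * ‖R x - S t (R x) - (t : ℂ) • x‖ ≤ t⁻¹ * (θ / 2 * t) := by
          have := ht.1
          gcongr
      _ = θ / 2 := by have := ht.1.ne'; field_simp
      _ < θ := by linarith
  refine ⟨S, Q, ⟨?_, ?_, h0lim, ?_⟩, hSK, ?_, ?_, ?_⟩
  · ext x
    have := hSlim 0 le_rfl x
    simp only [expGroup_zero, one_apply_eq_self] at this
    exact tendsto_nhds_unique this tendsto_const_nhds
  · intro s t hs ht
    ext x
    refine tendsto_nhds_unique (hSlim (s + t) (add_nonneg hs ht) x) ?_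
    have l1 := hSlim s hs (S t x)
    have l2 : Tendsto (fun n => expGroup (-A n) s (expGroup (-A n) t x - S t x)) atTop (𝓝 0) := by
      have := ((hSlim t ht x).sub_const (S t x)).norm.const_mul K
      rw [sub_self, norm_zero, mul_zero] at this
      refine squeeze_zero_norm (fun n => ?_) this
      exact (ContinuousLinearMap.le_opNorm _ _).trans
        (by gcongr; exact (hA n).norm_expGroup_le hC hs)
    have := l1.add l2
    rw [add_zero] at this
    refine this.congr fun n => ?_
    rw [expGroup_add]
    simp
  · intro x y
    rw [hB]
    constructor
    · rintro rfl
      exact hgen y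
    -- Applying `R` to the difference quotient makes it converge for every `x`, with limit `x`;
    -- comparison with the assumed limit gives `R y = x`.
    · intro hxy
      refine tendsto_nhds_unique ((R.continuous.tendsto y).comp hxy) ((hgen x).congr' ?_)
      filter_upwards [self_mem_nhdsWithin] with t ht
      simp [hcommR t (le_of_lt ht)]
  · intro t ht x
    rw [hQ_pos t ht]
    have l1 := ((R.continuous.tendsto _).comp (hQlim t ht x)).add (hεlim'.smul (hQlim t ht x))
    rw [zero_smul, add_zero] at l1
    refine tendsto_nhds_unique l1 ((hSlim t ht.le x).congr fun n => ?_)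
    have := congrArg (fun L : X →L[ℂ] X => L (expGroup (-A n) t x)) (hA n).right_inv
    simpa using this.symm
  · intro t ht
    rw [hQ_pos t ht]
    exact hQK t ht
  · intro x
    have hm : ∀ n, StronglyMeasurable
        ((Ioi (0 : ℝ)).indicator fun t => (A n * expGroup (-A n) t) x) := by
      intro n
      have := continuous_expGroup (-A n)
      have hc : Continuous fun t => (A n * expGroup (-A n) t) x := by fun_prop
      exact hc.stronglyMeasurable.indicator measurableSet_Ioi
    refine stronglyMeasurable_of_tendsto atTop hm ?_
    rw [tendsto_pi_nhds]
    intro t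
    by_cases ht : 0 < t
    · simpa [Set.indicator, ht, hQ_pos] using hQlim t ht x
    · simp [Set.indicator, ht, Q]

end IsSectorialInverse

end Generation

/-! ### General facts on strongly continuous semigroups -/

section SemigroupFacts

theorem tendsto_clm_apply {α X Y : Type*} [NormedAddCommGroup X] [NormedSpace ℂ X]
    [NormedAddCommGroup Y] [NormedSpace ℂ Y] {l : Filter α} {Φ : α → X →L[ℂ] Y} {K : ℝ}
    (hK : ∀ᶠ a in l, ‖Φ a‖ ≤ K) {y : α → X} {y₀ : X} {z : Y}
    (hΦ : Tendsto (fun a => Φ a y₀) l (𝓝 z)) (hy : Tendsto y l (𝓝 y₀)) :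
    Tendsto (fun a => Φ a (y a)) l (𝓝 z) := by
  have h0 : Tendsto (fun a => Φ a (y a - y₀)) l (𝓝 0) := by
    have := (hy.sub_const y₀).norm.const_mul K
    rw [sub_self, norm_zero, mul_zero] at this
    refine squeeze_zero_norm' ?_ this
    filter_upwards [hK] with a ha
    exact ((Φ a).le_opNorm _).trans (by gcongr)
  simpa using hΦ.add h0

theorem continuousOn_clm_apply {X Y : Type*} [NormedAddCommGroup X] [NormedSpace ℂ X]
    [NormedAddCommGroup Y] [NormedSpace ℂ Y] {s : Set ℝ} {Φ : ℝ → X →L[ℂ] Y} {K : ℝ}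
    (hK : ∀ a ∈ s, ‖Φ a‖ ≤ K) {y : ℝ → X}
    (hΦ : ∀ x, ContinuousOn (fun a => Φ a x) s) (hy : ContinuousOn y s) :
    ContinuousOn (fun a => Φ a (y a)) s := fun a ha =>
  tendsto_clm_apply (eventually_nhdsWithin_of_forall hK) (hΦ (y a) a ha) (hy a ha)

variable {X : Type*} [NormedAddCommGroup X] [NormedSpace ℂ X] {B : Submodule ℂ (X × X)}
  {S : ℝ → X →L[ℂ] X}

theorem tendsto_inv_sub_smul_iff {g : ℝ → X} {y : X} {s : ℝ} :
    Tendsto (fun r => (r - s)⁻¹ • g r) (𝓝[>] s) (𝓝 y) ↔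
      Tendsto (fun t : ℝ => ((t : ℂ)⁻¹) • g (s + t)) (𝓝[>] 0) (𝓝 y) := by
  have e : 𝓝[>] s = map (fun t => s + t) (𝓝[>] 0) := by
    simp
  rw [e, tendsto_map'_iff]
  refine tendsto_congr fun t => ?_
  simp only [Function.comp_apply, add_sub_cancel_left]
  rw [← Complex.ofReal_inv, Complex.coe_smul]

namespace IsSemigroupGeneratedByNeg

theorem commute (hS : IsSemigroupGeneratedByNeg B S) {s t : ℝ} (hs : 0 ≤ s) (ht : 0 ≤ t) (x : X) :
    S s (S t x) = S t (S s x) := by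
  rw [← ContinuousLinearMap.comp_apply, ← hS.map_add s t hs ht, add_comm, hS.map_add t s ht hs]
  rfl

theorem apply_add (hS : IsSemigroupGeneratedByNeg B S) {s t : ℝ} (hs : 0 ≤ s) (ht : 0 ≤ t) (x : X) :
    S (s + t) x = S s (S t x) := by rw [hS.map_add s t hs ht]; rfl

theorem mem_apply (hS : IsSemigroupGeneratedByNeg B S) {t : ℝ} (ht : 0 ≤ t) {x y : X}
    (h : (x, y) ∈ B) : (S t x, S t y) ∈ B := by
  rw [hS.generator] at h ⊢
  refine (((S t).continuous.tendsto y).comp h).congr' ?_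
  filter_upwards [self_mem_nhdsWithin] with h hh
  simp [hS.commute ht (le_of_lt hh)]

theorem tendsto_zero_Ici (hS : IsSemigroupGeneratedByNeg B S) (x : X) :
    Tendsto (fun t : ℝ => S t x) (𝓝[≥] 0) (𝓝 x) := by
  have : Ici (0 : ℝ) = insert 0 (Ioi 0) := by simp
  rw [this, nhdsWithin_insert, tendsto_sup]
  refine ⟨?_, hS.tendsto_zero x⟩
  rw [tendsto_pure_left]
  intro s hs
  rw [hS.map_zero]
  exact mem_of_mem_nhds hs

theorem tendsto_slope (hS : IsSemigroupGeneratedByNeg B S) {x y : X} (h : (x, y) ∈ B) {s : ℝ}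
    (hs : 0 ≤ s) : Tendsto (fun r => (r - s)⁻¹ • (S r x - S s x)) (𝓝[>] s) (𝓝 (-S s y)) := by
  rw [tendsto_inv_sub_smul_iff (g := fun r => S r x - S s x)]
  have := (((S s).continuous.tendsto y).comp ((hS.generator x y).1 h)).neg
  refine this.congr' ?_
  filter_upwards [self_mem_nhdsWithin] with t ht
  simp only [Function.comp_apply, map_smul, map_sub, hS.apply_add hs (le_of_lt ht)]
  rw [← smul_neg, neg_sub]

/-- The orbit of an element of the domain is right differentiable. -/
theorem hasDerivWithinAt (hS : IsSemigroupGeneratedByNeg B S) {x y : X} (h : (x, y) ∈ B) {s : ℝ}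
    (hs : 0 ≤ s) : HasDerivWithinAt (fun r => S r x) (-S s y) (Ioi s) s := by
  rw [hasDerivWithinAt_iff_tendsto_slope' self_notMem_Ioi]
  exact hS.tendsto_slope h hs

variable [CompleteSpace X]

/-- Otherwise the norms blow up along a sequence of times tending to `0`, on which strong continuity
and Banach-Steinhaus force boundedness. -/
theorem exists_bound_near_zero (hS : IsSemigroupGeneratedByNeg B S) :
    ∃ τ > 0, ∃ K, ∀ t ∈ Icc 0 τ, ‖S t‖ ≤ K := by
  by_contra! hcon
  choose t ht hn using fun n : ℕ => hcon (1 / ((n : ℝ) + 1)) (by positivity) n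
  have htlim : Tendsto t atTop (𝓝[≥] 0) := by
    refine tendsto_nhdsWithin_iff.2 ⟨?_, Eventually.of_forall fun n => (ht n).1⟩
    exact squeeze_zero (fun n => (ht n).1) (fun n => (ht n).2)
      tendsto_one_div_add_atTop_nhds_zero_nat
  obtain ⟨C, hC⟩ := banach_steinhaus (g := fun n => S (t n)) fun x => by
    have := ((hS.tendsto_zero_Ici x).comp htlim).norm
    obtain ⟨C, hC⟩ := this.bddAbove_range
    exact ⟨C, fun n => hC ⟨n, rfl⟩⟩
  obtain ⟨n, hn'⟩ := exists_nat_gt C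
  linarith [hn n, hC n]

theorem exists_bound (hS : IsSemigroupGeneratedByNeg B S) (T : ℝ) :
    ∃ K, 0 ≤ K ∧ ∀ t ∈ Icc 0 T, ‖S t‖ ≤ K := by
  obtain ⟨τ, hτ, K, hK⟩ := hS.exists_bound_near_zero
  have hK0 : 0 ≤ K := (norm_nonneg _).trans (hK 0 ⟨le_rfl, hτ.le⟩)
  have step : ∀ n : ℕ, ∃ K', 0 ≤ K' ∧ ∀ t ∈ Icc 0 ((n + 1) * τ), ‖S t‖ ≤ K' := by
    intro n
    induction n with
    | zero => exact ⟨K, hK0, by simpa using hK⟩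
    | succ n ih =>
      obtain ⟨K', hK'0, hK'⟩ := ih
      refine ⟨max K (K * K'), le_max_of_le_left hK0, fun t ht => ?_⟩
      rcases le_total t τ with h | h
      · exact (hK t ⟨ht.1, h⟩).trans (le_max_left _ _)
      · refine le_max_of_le_right ?_
        have e : t = τ + (t - τ) := by ring
        have h2 := ht.2
        push_cast at h2
        rw [e, hS.map_add _ _ hτ.le (sub_nonneg.2 h)]
        exact (ContinuousLinearMap.opNorm_comp_le _ _).trans
          (mul_le_mul (hK τ ⟨hτ.le, le_rfl⟩) (hK' _ ⟨sub_nonneg.2 h, by linarith⟩)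
            (norm_nonneg _) hK0)
  obtain ⟨n, hn⟩ := exists_nat_gt (T / τ)
  obtain ⟨K', hK'0, hK'⟩ := step n
  refine ⟨K', hK'0, fun t ht => hK' t ⟨ht.1, ht.2.trans ?_⟩⟩
  rw [div_lt_iff₀ hτ] at hn
  nlinarith

theorem continuousOn (hS : IsSemigroupGeneratedByNeg B S) (x : X) :
    ContinuousOn (fun t => S t x) (Ici 0) := by
  intro t₀ ht₀
  obtain ⟨K, hK0, hK⟩ := hS.exists_bound (t₀ + 1)
  have hlim : Tendsto (fun t => |t - t₀|) (𝓝[Ici 0] t₀) (𝓝[≥] 0) := by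
    refine tendsto_nhdsWithin_iff.2 ⟨?_, Eventually.of_forall fun n => mem_Ici.2 (abs_nonneg _)⟩
    have : Continuous fun t : ℝ => |t - t₀| := by fun_prop
    have h := this.tendsto t₀
    rw [sub_self, abs_zero] at h
    exact h.mono_left nhdsWithin_le_nhds
  have h0 := (((hS.tendsto_zero_Ici x).comp hlim).sub_const x).norm.const_mul K
  rw [sub_self, norm_zero, mul_zero] at h0
  rw [ContinuousWithinAt, tendsto_iff_norm_sub_tendsto_zero]
  refine squeeze_zero' (Eventually.of_forall fun _ => norm_nonneg _) ?_ h0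
  filter_upwards [self_mem_nhdsWithin, nhdsWithin_le_nhds (Iio_mem_nhds (lt_add_one t₀))]
    with t ht ht1
  have ht : 0 ≤ t := ht
  have ht1 : t < t₀ + 1 := ht1
  have ht₀ : 0 ≤ t₀ := ht₀
  simp only [Function.comp_apply]
  rcases le_total t t₀ with h | h
  · have e : S t₀ x = S t (S |t - t₀| x) := by
      rw [← hS.apply_add ht (abs_nonneg _), abs_of_nonpos (sub_nonpos.2 h)]; congr 2; ring
    rw [norm_sub_rev, e, ← map_sub]
    exact ((S t).le_opNorm _).trans (by gcongr; exact hK t ⟨ht, ht1.le⟩)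
  · have e : S t x = S t₀ (S |t - t₀| x) := by
      rw [← hS.apply_add ht₀ (abs_nonneg _), abs_of_nonneg (sub_nonneg.2 h)]; congr 2; ring
    rw [e, ← map_sub]
    exact ((S t₀).le_opNorm _).trans (by gcongr; exact hK t₀ ⟨ht₀, by linarith⟩)

theorem integral_apply (hS : IsSemigroupGeneratedByNeg B S) {x y : X} (h : (x, y) ∈ B) {t : ℝ}
    (ht : 0 ≤ t) : ∫ s in (0 : ℝ)..t, S s y = x - S t x := by
  have hcont : ∀ z, ContinuousOn (fun r => S r z) (uIcc 0 t) := fun z =>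
    (hS.continuousOn z).mono (by rw [uIcc_of_le ht]; exact Icc_subset_Ici_self)
  have := intervalIntegral.integral_eq_sub_of_hasDeriv_right (hcont x)
    (f' := fun s => -S s y) (fun s hs => hS.hasDerivWithinAt h (by
      rw [min_eq_left ht] at hs; exact hs.1.le)) (hcont y).neg.intervalIntegrable
  rw [intervalIntegral.integral_neg, hS.map_zero] at this
  rw [← neg_neg (∫ s in (0 : ℝ)..t, S s y), this]
  simp

/-- An operator intertwining the generators intertwines the semigroups. -/
theorem intertwine {Y : Type*} [NormedAddCommGroup Y] [NormedSpace ℂ Y] [CompleteSpace Y]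
    {B' : Submodule ℂ (Y × Y)} {S' : ℝ → Y →L[ℂ] Y} (hS : IsSemigroupGeneratedByNeg B S)
    (hS' : IsSemigroupGeneratedByNeg B' S') (P : X →L[ℂ] Y)
    (hP : ∀ x y, (x, y) ∈ B → (P x, P y) ∈ B') (hd : Dense {x | ∃ y, (x, y) ∈ B})
    {t : ℝ} (ht : 0 ≤ t) (x : X) : P (S t x) = S' t (P x) := by
  suffices h : (P ∘L S t) = (S' t ∘L P) from congrArg (fun L : X →L[ℂ] Y => L x) h
  apply DFunLike.coe_injective
  refine Continuous.ext_on hd (ContinuousLinearMap.continuous _) (ContinuousLinearMap.continuous _) ?_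
  rintro x ⟨y, hxy⟩
  obtain ⟨K, hK0, hK⟩ := hS'.exists_bound t
  -- This function joins the two sides of the claim; for `x` in the domain its right derivative
  -- vanishes, so it is constant.
  have hcont : ContinuousOn (fun s => S' (t - s) (P (S s x))) (Icc 0 t) := by
    refine continuousOn_clm_apply (K := K) (fun s hs => hK _ ⟨?_, ?_⟩) (fun z => ?_) ?_
    · linarith [hs.2]
    · linarith [hs.1]
    · refine (hS'.continuousOn z).comp (by fun_prop) fun s hs => ?_
      have := hs.2
      simpa using this
    · exact P.continuous.comp_continuousOn ((hS.continuousOn x).mono Icc_subset_Ici_self)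
  have hder : ∀ s ∈ Ico 0 t,
      HasDerivWithinAt (fun s => S' (t - s) (P (S s x))) 0 (Ici s) s := by
    intro s hs
    rw [← hasDerivWithinAt_Ioi_iff_Ici, hasDerivWithinAt_iff_tendsto_slope' self_notMem_Ioi]
    have l1 := (P.continuous.tendsto _).comp (hS.tendsto_slope hxy hs.1)
    have l2 := (hS'.generator _ _).1 (hP _ _ (hS.mem_apply hs.1 hxy))
    have l3 : Tendsto (fun r => (r - s)⁻¹ • (P (S s x) - S' (r - s) (P (S s x)))) (𝓝[>] s)
        (𝓝 (P (S s y))) := by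
      rw [tendsto_inv_sub_smul_iff (g := fun r => P (S s x) - S' (r - s) (P (S s x)))]
      simpa using l2
    have l4 := l1.add l3
    rw [map_neg, neg_add_cancel] at l4
    have hev : ∀ᶠ r in 𝓝[>] s, r ∈ Ioc s t :=
      Ioc_mem_nhdsGT hs.2
    -- The slope is `S'(t - r)` applied to a vector tending to `0`, so the uniform bound on `S'`
    -- suffices.
    have l5 : Tendsto (fun r => S' (t - r) ((P ∘ fun r => (r - s)⁻¹ • (S r x - S s x)) r +
        (r - s)⁻¹ • (P (S s x) - S' (r - s) (P (S s x))))) (𝓝[>] s) (𝓝 0) := by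
      refine tendsto_clm_apply (K := K) ?_ ?_ l4
      · filter_upwards [hev] with r hr
        exact hK _ ⟨by linarith [hr.2], by linarith [hr.1, hs.1]⟩
      · simp
    refine l5.congr' ?_
    filter_upwards [hev] with r hr
    have e : t - s = t - r + (r - s) := by ring
    have hreal : ∀ (c : ℝ) (z : X), P (c • z) = c • P z := fun c z => by
      rw [← Complex.coe_smul, map_smul, Complex.coe_smul]
    have hreal' : ∀ (c : ℝ) (z : Y), S' (t - r) (c • z) = c • S' (t - r) z := fun c z => by
      rw [← Complex.coe_smul, map_smul, Complex.coe_smul]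
    simp only [Function.comp_apply, slope, vsub_eq_sub]
    rw [hreal, ← smul_add, hreal', e, hS'.apply_add (by linarith [hr.2]) (by linarith [hr.1])]
    congr 1
    rw [map_sub, ← map_sub (S' (t - r))]
    congr 1
    abel
  have := constant_of_has_deriv_right_zero hcont hder t ⟨ht, le_rfl⟩
  simpa [hS.map_zero, hS'.map_zero] using this

theorem unique {S' : ℝ → X →L[ℂ] X} (hS : IsSemigroupGeneratedByNeg B S)
    (hS' : IsSemigroupGeneratedByNeg B S') (hd : Dense {x | ∃ y, (x, y) ∈ B}) {t : ℝ}
    (ht : 0 ≤ t) : S t = S' t := by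
  ext x
  exact hS.intertwine hS' (ContinuousLinearMap.id ℂ X) (fun _ _ h => h) hd ht x

end IsSemigroupGeneratedByNeg

theorem expNeg_spec (h : ∃ S, IsSemigroupGeneratedByNeg B S) :
    IsSemigroupGeneratedByNeg B (expNeg B) := by
  rw [expNeg, dif_pos h]
  exact h.choose_spec

end SemigroupFacts

/-! ### Strong measurability of vector-valued functions -/

section Measurability

variable {α : Type*} [MeasurableSpace α] {μ : Measure α}

/-- Immediate for simple `g`, then by approximation, as each `Φ a` is continuous. Measurability of
`Φ` in operator norm is not needed. -/
theorem aestronglyMeasurable_clm_apply {X Y : Type*} [NormedAddCommGroup X] [NormedSpace ℂ X]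
    [NormedAddCommGroup Y] [NormedSpace ℂ Y] {Φ : α → X →L[ℂ] Y} {g : α → X}
    (hΦ : ∀ x, AEStronglyMeasurable (fun a => Φ a x) μ) (hg : AEStronglyMeasurable g μ) :
    AEStronglyMeasurable (fun a => Φ a (g a)) μ := by
  have hsimple : ∀ φ : SimpleFunc α X, AEStronglyMeasurable (fun a => Φ a (φ a)) μ := by
    intro φ
    have e : (fun a => Φ a (φ a)) =
        ∑ c ∈ φ.range, (φ ⁻¹' {c}).indicator fun a => Φ a c := by
      funext a
      rw [Finset.sum_apply, Finset.sum_eq_single (φ a)]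
      · simp
      · intro c _ hc
        exact indicator_of_notMem (fun h : φ a = c => hc h.symm) _
      · intro h
        exact absurd (φ.mem_range_self a) h
    rw [e]
    exact Finset.aestronglyMeasurable_sum _ fun c _ =>
      (hΦ c).indicator (φ.measurableSet_fiber c)
  refine aestronglyMeasurable_of_tendsto_ae (u := atTop)
    (f := fun n a => Φ a (hg.stronglyMeasurable_mk.approx n a)) (fun n => hsimple _) ?_
  filter_upwards [hg.ae_eq_mk] with a ha
  rw [ha]
  exact ((Φ a).continuous.tendsto _).comp (hg.stronglyMeasurable_mk.tendsto_approx a)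

/-- The Pettis measurability theorem in a separable Hilbert space. -/
theorem aestronglyMeasurable_of_inner {V : Type*} [NormedAddCommGroup V] [InnerProductSpace ℂ V]
    [CompleteSpace V] [TopologicalSpace.SeparableSpace V] {g : α → V}
    (hg : ∀ w, AEMeasurable (fun a => inner ℂ w (g a)) μ) : AEStronglyMeasurable g μ := by
  let d := TopologicalSpace.denseSeq V
  -- Projections onto these finite-dimensional spaces converge strongly to the identity, and their
  -- coordinates are scalar products with `g`.
  let U : ℕ → Submodule ℂ V := fun n => Submodule.span ℂ (d '' Iio n)
  have hfin : ∀ n, FiniteDimensional ℂ (U n) := fun n =>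
    FiniteDimensional.span_of_finite ℂ ((finite_Iio n).image d)
  have hmono : Monotone U := fun m n h => Submodule.span_mono (image_mono (Iio_subset_Iio h))
  have hdense : ⊤ ≤ (⨆ n, U n).topologicalClosure := by
    intro x _
    refine closure_mono ?_ (TopologicalSpace.denseRange_denseSeq V x)
    rintro _ ⟨n, rfl⟩
    exact (le_iSup U (n + 1)) (Submodule.subset_span ⟨n, Nat.lt_succ_self n, rfl⟩)
  refine aestronglyMeasurable_of_tendsto_ae (u := atTop)
    (f := fun n a => (U n).starProjection (g a)) (fun n => ?_)
    (ae_of_all _ fun a => Submodule.starProjection_tendsto_self U hmono (g a) hdense)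
  let b := stdOrthonormalBasis ℂ (U n)
  have e : (fun a => (U n).starProjection (g a)) =
      fun a => ∑ i, inner ℂ (b i : V) (g a) • (b i : V) := by
    funext a
    rw [b.starProjection_eq_sum_rankOne]
    simp
  rw [e]
  exact Finset.aestronglyMeasurable_fun_sum _ fun i _ =>
    (hg (b i)).aestronglyMeasurable.smul_const _

end Measurability

/-! ### Integration by parts -/

section Parts

variable {X Y : Type*} [NormedAddCommGroup X] [NormedSpace ℂ X] [CompleteSpace X]
  [NormedAddCommGroup Y] [NormedSpace ℂ Y] [CompleteSpace Y]

/-- Integration by parts for a strongly continuously differentiable family of operators and an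
indefinite integral. -/
theorem integral_clm_apply_by_parts {t K : ℝ} (ht : 0 ≤ t) {Ψ Ψ' : ℝ → X →L[ℂ] Y} {g U : ℝ → X}
    (hm : ∀ x, AEStronglyMeasurable (fun s => Ψ' s x) (volume.restrict (Ioc 0 t)))
    (hK : ∀ s ∈ Ioc 0 t, ‖Ψ' s‖ ≤ K)
    (hΨ : ∀ s ∈ Icc 0 t, ∀ x, Ψ s x = Ψ t x - ∫ τ in s..t, Ψ' τ x)
    (hg : IntegrableOn g (Ioc 0 t)) (hU : ∀ s ∈ Icc 0 t, U s = U 0 + ∫ r in (0 : ℝ)..s, g r) :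
    ∫ s in (0 : ℝ)..t, Ψ s (g s) = Ψ t (U t) - Ψ 0 (U 0) - ∫ s in (0 : ℝ)..t, Ψ' s (U s) := by
  set μ : Measure ℝ := volume.restrict (Ioc 0 t) with hμ
  -- Integrand on the triangle `s < τ`. Integrating first in `τ` produces `Ψ t - Ψ s` applied to `g
  -- s`, first in `s` produces `Ψ' τ (U τ - U 0)`; Fubini equates the totals.
  let F : ℝ × ℝ → Y := {p : ℝ × ℝ | p.1 < p.2}.indicator fun p => Ψ' p.2 (g p.1)
  have hmeas : AEStronglyMeasurable (fun p : ℝ × ℝ => Ψ' p.2 (g p.1)) (μ.prod μ) :=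
    aestronglyMeasurable_clm_apply (fun x => (hm x).comp_snd) hg.aestronglyMeasurable.comp_fst
  have hFi : Integrable F (μ.prod μ) := by
    refine Integrable.indicator ?_ (measurableSet_lt measurable_fst measurable_snd)
    have hb : Integrable (fun p : ℝ × ℝ => K * ‖g p.1‖) (μ.prod μ) :=
      (Integrable.comp_fst (ν := μ) hg.norm).const_mul K
    refine hb.mono' hmeas ?_
    have h2 : ∀ᵐ p : ℝ × ℝ ∂(μ.prod μ), p.2 ∈ Ioc 0 t :=
      Measure.quasiMeasurePreserving_snd.ae (ae_restrict_mem measurableSet_Ioc)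
    filter_upwards [h2] with p hp
    exact ((Ψ' p.2).le_opNorm _).trans (by gcongr; exact hK _ hp)
  have hΨ'i : ∀ x, Integrable (fun s => Ψ' s x) μ := fun x => by
    refine Integrable.mono' (integrable_const (K * ‖x‖)) (hm x) ?_
    filter_upwards [ae_restrict_mem measurableSet_Ioc] with s hs
    exact ((Ψ' s).le_opNorm _).trans (by gcongr; exact hK _ hs)
  have inner₁ : ∀ s ∈ Ioc 0 t, ∫ τ, F (s, τ) ∂μ = Ψ t (g s) - Ψ s (g s) := by
    intro s hs
    have e : (fun τ => F (s, τ)) = (Ioi s).indicator fun τ => Ψ' τ (g s) := by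
      funext τ
      simp [F, indicator]
    rw [e, integral_indicator measurableSet_Ioi, hμ, Measure.restrict_restrict measurableSet_Ioi,
      show Ioi s ∩ Ioc 0 t = Ioc s t from ?_, ← intervalIntegral.integral_of_le hs.2,
      hΨ s ⟨hs.1.le, hs.2⟩]
    · abel
    · ext τ
      simp only [mem_inter_iff, mem_Ioi, mem_Ioc]
      exact ⟨fun h => ⟨h.1, h.2.2⟩, fun h => ⟨h.1, hs.1.trans h.1, h.2⟩⟩
  have inner₂ : ∀ τ ∈ Ioc 0 t, ∫ s, F (s, τ) ∂μ = Ψ' τ (U τ) - Ψ' τ (U 0) := by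
    intro τ hτ
    have e : (fun s => F (s, τ)) = (Iio τ).indicator fun s => Ψ' τ (g s) := by
      funext s
      simp [F, indicator]
    have hset : Iio τ ∩ Ioc 0 t = Ioo 0 τ := by
      ext s
      simp only [mem_inter_iff, mem_Iio, mem_Ioc, mem_Ioo]
      exact ⟨fun h => ⟨h.2.1, h.1⟩, fun h => ⟨h.2, h.1, h.2.le.trans hτ.2⟩⟩
    rw [e, integral_indicator measurableSet_Iio, hμ, Measure.restrict_restrict measurableSet_Iio,
      hset, ContinuousLinearMap.integral_comp_comm, hU τ ⟨hτ.1.le, hτ.2⟩,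
      intervalIntegral.integral_of_le hτ.1.le, integral_Ioc_eq_integral_Ioo, map_add]
    · abel
    · exact hg.mono_set fun s hs => ⟨hs.1, hs.2.le.trans hτ.2⟩
  have i₁ : Integrable (fun s => Ψ t (g s) - Ψ s (g s)) μ := by
    refine hFi.integral_prod_left.congr ?_
    filter_upwards [ae_restrict_mem measurableSet_Ioc] with s hs using inner₁ s hs
  have i₂ : Integrable (fun τ => Ψ' τ (U τ) - Ψ' τ (U 0)) μ := by
    refine hFi.integral_prod_right.congr ?_
    filter_upwards [ae_restrict_mem measurableSet_Ioc] with s hs using inner₂ s hs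
  have hΨg : Integrable (fun s => Ψ t (g s)) μ := (Ψ t).integrable_comp hg
  have swap := integral_integral_swap (f := fun s τ => F (s, τ)) hFi
  rw [integral_congr_ae ((ae_restrict_mem measurableSet_Ioc).mono fun s hs => inner₁ s hs),
    integral_congr_ae ((ae_restrict_mem measurableSet_Ioc).mono fun s hs => inner₂ s hs)] at swap
  have i₃ : Integrable (fun s => Ψ s (g s)) μ := by
    exact (hΨg.sub i₁).congr (ae_of_all _ fun s => by simp)
  have i₄ : Integrable (fun s => Ψ' s (U s)) μ := by
    exact (i₂.add (hΨ'i (U 0))).congr (ae_of_all _ fun s => by simp)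
  rw [integral_sub hΨg i₃, integral_sub i₄ (hΨ'i _), ContinuousLinearMap.integral_comp_comm _ hg,
    ← intervalIntegral.integral_of_le ht, ← intervalIntegral.integral_of_le ht,
    ← intervalIntegral.integral_of_le ht, ← intervalIntegral.integral_of_le ht] at swap
  have h0 := hΨ 0 ⟨le_rfl, ht⟩ (U 0)
  have hUt := hU t ⟨ht, le_rfl⟩
  rw [hUt, map_add, h0]
  rw [sub_eq_iff_eq_add] at swap
  rw [swap]
  abel

end Parts

/-! ### Weak derivatives and indefinite integrals -/

section WeakDerivative

theorem MemL2.integrableOn {X : Type*} [NormedAddCommGroup X] {T : ℝ} {g : ℝ → X} (hg : MemL2 T g) : IntegrableOn g (Ioo 0 T) :=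
  MemLp.integrable (by norm_num) hg

variable {X : Type*} [NormedAddCommGroup X] [NormedSpace ℂ X]

/-- A test function with vanishing integral is the derivative of a test function. -/
theorem exists_deriv_eq_of_integral_eq_zero {T : ℝ} {θ : ℝ → ℝ} (hθ : ContDiff ℝ ∞ θ)
    (hc : HasCompactSupport θ) (hs : tsupport θ ⊆ Ioo 0 T) (h0 : ∫ t, θ t = 0) :
    ∃ η : ℝ → ℝ, ContDiff ℝ ∞ η ∧ HasCompactSupport η ∧ tsupport η ⊆ Ioo 0 T ∧ deriv η = θ := by
  rcases (tsupport θ).eq_empty_or_nonempty with he | hne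
  · rw [tsupport_eq_empty_iff] at he
    exact ⟨0, contDiff_const, HasCompactSupport.zero, by simp, by rw [he]; exact deriv_zero⟩
  obtain ⟨a, ha, hamin⟩ := hc.isCompact.exists_isLeast hne
  obtain ⟨b, hb, hbmax⟩ := hc.isCompact.exists_isGreatest hne
  have hzero : ∀ t, t ∉ Icc a b → θ t = 0 := fun t ht =>
    image_eq_zero_of_notMem_tsupport fun h => ht ⟨hamin h, hbmax h⟩
  -- The base point lies left of the support; beyond `b` the primitive vanishes because the total
  -- integral is `0`.
  let η : ℝ → ℝ := fun t => ∫ s in (a - 1)..t, θ s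
  have hder : ∀ t, HasDerivAt η (θ t) t := fun t =>
    intervalIntegral.integral_hasDerivAt_right (hθ.continuous.intervalIntegrable _ _)
      hθ.continuous.stronglyMeasurable.stronglyMeasurableAtFilter hθ.continuous.continuousAt
  have hderiv : deriv η = θ := funext fun t => (hder t).deriv
  have hηsupp : Function.support η ⊆ Icc a b := by
    intro t ht
    by_contra hn
    apply ht
    by_cases hta : t < a
    · refine intervalIntegral.integral_zero_ae (ae_of_all _ fun s hs => hzero s fun h => ?_)
      have : s < a := by
        rcases le_total (a - 1) t with h' | h'
        · rw [uIoc_of_le h'] at hs; linarith [hs.2]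
        · rw [uIoc_of_ge h'] at hs; linarith [hs.2]
      exact absurd h.1 (not_le.2 this)
    · have htb : b < t := by
        by_contra hh
        exact hn ⟨not_lt.1 hta, not_lt.1 hh⟩
      have hab : a ≤ b := hamin hb
      change ∫ s in (a - 1)..t, θ s = 0
      rw [intervalIntegral.integral_of_le (by linarith), ← h0]
      refine setIntegral_eq_integral_of_forall_compl_eq_zero fun s hs => hzero s fun h => hs ?_
      exact ⟨by linarith [h.1], by linarith [h.2]⟩
  have hηt : tsupport η ⊆ Icc a b := closure_minimal hηsupp isClosed_Icc
  refine ⟨η, ?_, HasCompactSupport.of_support_subset_isCompact isCompact_Icc hηsupp,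
    hηt.trans (Icc_subset_Ioo (hs ha).1 (hs hb).2), hderiv⟩
  rw [contDiff_infty_iff_deriv]
  exact ⟨fun t => (hder t).differentiableAt, by rw [hderiv]; exact hθ⟩

theorem exists_testFunction_integral_eq_one {T : ℝ} (hT : 0 < T) :
    ∃ ψ : ℝ → ℝ, ContDiff ℝ ∞ ψ ∧ HasCompactSupport ψ ∧ tsupport ψ ⊆ Ioo 0 T ∧ ∫ t, ψ t = 1 := by
  let φ : ContDiffBump (T / 2) := ⟨T / 8, T / 4, by positivity, by linarith⟩
  refine ⟨φ.normed volume, φ.contDiff_normed, φ.hasCompactSupport_normed, ?_, φ.integral_normed⟩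
  rw [φ.tsupport_normed_eq, Real.closedBall_eq_Icc]
  change Icc (T / 2 - T / 4) (T / 2 + T / 4) ⊆ _
  exact Icc_subset_Ioo (by linarith) (by linarith)

theorem integrableOn_smul_of_continuous {s : Set ℝ} {T : ℝ} (hs : s ⊆ Icc 0 T)
    (hsm : MeasurableSet s) {φ : ℝ → ℝ}
    (hφ : Continuous φ) {w : ℝ → X} (hw : IntegrableOn w s) :
    IntegrableOn (fun t => φ t • w t) s := by
  obtain ⟨K, hK⟩ := isCompact_Icc.exists_bound_of_continuousOn (hφ.continuousOn (s := Icc 0 T))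
  refine (hw.norm.const_mul K).mono' (hφ.aestronglyMeasurable.smul hw.aestronglyMeasurable) ?_
  filter_upwards [ae_restrict_mem hsm] with t ht
  rw [norm_smul]
  gcongr
  exact hK t (hs ht)

variable [CompleteSpace X]

/-- Integration by parts for multiples of the identity; the boundary terms vanish because `φ` does
at `0` and `T`. -/
theorem integral_deriv_smul_primitive {T : ℝ} (hT : 0 < T) {g' : ℝ → X}
    (hg' : IntegrableOn g' (Ioo 0 T)) {φ : ℝ → ℝ} (hφ : ContDiff ℝ ∞ φ)
    (hs : tsupport φ ⊆ Ioo 0 T) :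
    ∫ t in Ioo 0 T, deriv φ t • ∫ s in (0 : ℝ)..t, g' s = -∫ t in Ioo 0 T, φ t • g' t := by
  have h0 : ∀ t, t ∉ Ioo 0 T → φ t = 0 := fun t ht =>
    image_eq_zero_of_notMem_tsupport fun h => ht (hs h)
  have hd : Continuous (deriv φ) := hφ.continuous_deriv (by simp)
  obtain ⟨K, hK⟩ := isCompact_Icc.exists_bound_of_continuousOn (hd.continuousOn (s := Icc 0 T))
  have key := integral_clm_apply_by_parts (K := K) hT.le
    (Ψ := fun s => (φ s : ℂ) • ContinuousLinearMap.id ℂ X)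
    (Ψ' := fun s => ((deriv φ s : ℝ) : ℂ) • ContinuousLinearMap.id ℂ X)
    (g := g') (U := fun t => ∫ s in (0 : ℝ)..t, g' s)
    (fun x => by
      have hc : Continuous fun s => (((deriv φ s : ℝ) : ℂ) • ContinuousLinearMap.id ℂ X) x := by
        simp only [smul_apply, ContinuousLinearMap.id_apply]
        fun_prop
      exact hc.aestronglyMeasurable)
    (fun s hs' => by
      rw [norm_smul, Complex.norm_real]
      calc ‖deriv φ s‖ * ‖ContinuousLinearMap.id ℂ X‖ ≤ K * 1 := by
            refine mul_le_mul (hK s ⟨hs'.1.le, hs'.2⟩) ContinuousLinearMap.norm_id_le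
              (norm_nonneg _) ((norm_nonneg _).trans (hK s ⟨hs'.1.le, hs'.2⟩))
        _ = K := mul_one K)
    (fun s _ x => by
      simp only [smul_apply, ContinuousLinearMap.id_apply, Complex.coe_smul]
      rw [intervalIntegral.integral_smul_const, intervalIntegral.integral_deriv_eq_sub
        (fun r _ => (hφ.differentiable (by simp)).differentiableAt) (hd.intervalIntegrable _ _),
        ← sub_smul]
      congr 1; ring)
    (by rwa [integrableOn_Ioc_iff_integrableOn_Ioo])
    (fun s _ => by simp)
  simp only [smul_apply, ContinuousLinearMap.id_apply, Complex.coe_smul, h0 0 (by simp),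
    h0 T (by simp), Complex.ofReal_zero, zero_smul, zero_apply, sub_zero, zero_sub] at key
  rw [intervalIntegral.integral_of_le hT.le, intervalIntegral.integral_of_le hT.le,
    integral_Ioc_eq_integral_Ioo, integral_Ioc_eq_integral_Ioo] at key
  rw [key, neg_neg]

/-- The lemma of du Bois-Reymond: a function with a weak derivative is an indefinite integral. -/
theorem IsWeakDeriv.exists_ae_eq {T : ℝ} (hT : 0 < T) {g g' : ℝ → X}
    (h : IsWeakDeriv T g g') (hg : IntegrableOn g (Ioo 0 T)) (hg' : IntegrableOn g' (Ioo 0 T)) :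
    ∃ c : X, ∀ᵐ t ∂(volume.restrict (Ioo 0 T)), g t = c + ∫ s in (0 : ℝ)..t, g' s := by
  have hg'i : IntegrableOn g' (Icc 0 T) := by rwa [integrableOn_Icc_iff_integrableOn_Ioo]
  have hprim : IntegrableOn (fun t => ∫ s in (0 : ℝ)..t, g' s) (Ioo 0 T) :=
    ((intervalIntegral.continuousOn_primitive_interval (by rwa [uIcc_of_le hT.le])).integrableOn_compact
      isCompact_uIcc).mono_set (by rw [uIcc_of_le hT.le]; exact Ioo_subset_Icc_self)
  let w : ℝ → X := fun t => g t - ∫ s in (0 : ℝ)..t, g' s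
  have hw : IntegrableOn w (Ioo 0 T) := hg.sub hprim
  have hsmul : ∀ φ : ℝ → ℝ, Continuous φ → ∀ v : ℝ → X, IntegrableOn v (Ioo 0 T) →
      IntegrableOn (fun t => φ t • v t) (Ioo 0 T) := fun φ hφ v hv =>
    integrableOn_smul_of_continuous Ioo_subset_Icc_self measurableSet_Ioo hφ hv
  have hw0 : ∀ φ : ℝ → ℝ, ContDiff ℝ ∞ φ → HasCompactSupport φ → tsupport φ ⊆ Ioo 0 T →
      ∫ t in Ioo 0 T, deriv φ t • w t = 0 := by
    intro φ hφ hφc hφs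
    have hd : Continuous (deriv φ) := hφ.continuous_deriv (by simp)
    simp only [w, smul_sub]
    rw [integral_sub (hsmul _ hd _ hg) (hsmul _ hd _ hprim), h φ hφ hφc hφs,
      integral_deriv_smul_primitive hT hg' hφ hφs, sub_self]
  obtain ⟨ψ, hψ, hψc, hψs, hψ1⟩ := exists_testFunction_integral_eq_one hT
  have hset : ∀ φ : ℝ → ℝ, tsupport φ ⊆ Ioo 0 T → ∫ t in Ioo 0 T, φ t = ∫ t, φ t :=
    fun φ hφ => setIntegral_eq_integral_of_forall_compl_eq_zero fun t ht =>
      image_eq_zero_of_notMem_tsupport fun h => ht (hφ h)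
  -- The constant is read off by testing with a function of integral one.
  set c : X := ∫ t in Ioo 0 T, ψ t • w t with hc
  refine ⟨c, ?_⟩
  have hwc : IntegrableOn (fun t => w t - c) (Ioo 0 T) :=
    hw.sub (integrableOn_const (by simp))
  have hae := isOpen_Ioo.ae_eq_zero_of_integral_contDiff_smul_eq_zero (μ := volume)
    hwc.locallyIntegrableOn (fun φ hφ hφc hφs => ?_)
  · rw [ae_restrict_iff' measurableSet_Ioo]
    filter_upwards [hae] with t ht htm
    have := ht htm
    simp only [w, sub_eq_zero] at this
    rw [← this]; abel
  · set m : ℝ := ∫ t, φ t with hm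
    -- Removing the mean of `φ` leaves the derivative of a test function, to which `hw0` applies.
    let θ : ℝ → ℝ := fun t => φ t - m * ψ t
    have hθ : ContDiff ℝ ∞ θ := hφ.sub (contDiff_const.mul hψ)
    have hθsupp : tsupport θ ⊆ tsupport φ ∪ tsupport ψ := by
      refine closure_minimal (fun t ht => ?_)
        ((isClosed_tsupport φ).union (isClosed_tsupport ψ))
      by_contra hn
      rw [mem_union, not_or] at hn
      exact ht (by simp [θ, image_eq_zero_of_notMem_tsupport hn.1,
        image_eq_zero_of_notMem_tsupport hn.2])
    have hθc : HasCompactSupport θ :=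
      (hφc.isCompact.union hψc.isCompact).of_isClosed_subset (isClosed_tsupport θ) hθsupp
    have hθ0 : ∫ t, θ t = 0 := by
      rw [integral_sub (hφ.continuous.integrable_of_hasCompactSupport hφc)
        ((hψ.continuous.integrable_of_hasCompactSupport hψc).const_mul m), integral_const_mul,
        hψ1, mul_one, ← hm, sub_self]
    obtain ⟨η, hη, hηc, hηs, hηd⟩ := exists_deriv_eq_of_integral_eq_zero hθ hθc
      (hθsupp.trans (union_subset hφs hψs)) hθ0
    have hθw := hw0 η hη hηc hηs
    rw [hηd] at hθw
    have e1 : ∫ t in Ioo 0 T, θ t • w t = (∫ t in Ioo 0 T, φ t • w t) - m • c := by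
      have hψm : Integrable (fun t => m • ψ t • w t) (volume.restrict (Ioo 0 T)) :=
        (hsmul _ hψ.continuous _ hw).smul m
      simp only [θ, sub_smul, mul_smul]
      rw [integral_sub (hsmul _ hφ.continuous _ hw)
        hψm, integral_smul]
    rw [e1] at hθw
    have e2 : ∫ t, φ t • (w t - c) = ∫ t in Ioo 0 T, φ t • (w t - c) :=
      (setIntegral_eq_integral_of_forall_compl_eq_zero fun t ht => by
        rw [image_eq_zero_of_notMem_tsupport fun h => ht (hφs h), zero_smul]).symm
    rw [e2]
    simp only [smul_sub]
    rw [integral_sub (hsmul _ hφ.continuous _ hw)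
      (hsmul _ hφ.continuous _ (integrableOn_const (by simp))), integral_smul_const,
      hset φ hφs, ← hm, hθw]

/-- The primitive is continuous and agrees with `U` almost everywhere, hence on all of `[0,T]`,
endpoints included. -/
theorem IsContRep.eq_add_integral {T : ℝ} (hT : 0 < T) {g g' U : ℝ → X}
    (hU : IsContRep T g U) (h : IsWeakDeriv T g g') (hg : IntegrableOn g (Ioo 0 T))
    (hg' : IntegrableOn g' (Ioo 0 T)) :
    ∀ t ∈ Icc 0 T, U t = U 0 + ∫ s in (0 : ℝ)..t, g' s := by
  obtain ⟨c, hc⟩ := h.exists_ae_eq hT hg hg'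
  have hcont : ContinuousOn (fun t => c + ∫ s in (0 : ℝ)..t, g' s) (Icc 0 T) := by
    have := intervalIntegral.continuousOn_primitive_interval (μ := volume) (f := g') (a := 0)
      (b := T) (by rw [uIcc_of_le hT.le]; rwa [integrableOn_Icc_iff_integrableOn_Ioo])
    rw [uIcc_of_le hT.le] at this
    exact continuousOn_const.add this
  have heq : EqOn U (fun t => c + ∫ s in (0 : ℝ)..t, g' s) (Icc 0 T) := by
    refine Measure.eqOn_Icc_of_ae_eq volume hT.ne ?_ hU.1 hcont
    rw [← restrict_Ioo_eq_restrict_Icc]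
    filter_upwards [hU.2, hc] with t h1 h2
    rw [h1, h2]
  intro t ht
  rw [heq ht, heq ⟨le_rfl, hT.le⟩]
  simp

end WeakDerivative

/-! ### Duhamel's formula -/

section Duhamel

variable {X : Type*} [NormedAddCommGroup X] [NormedSpace ℂ X] [CompleteSpace X]
  {B : Submodule ℂ (X × X)} {S : ℝ → X →L[ℂ] X}

namespace IsSemigroupGeneratedByNeg

theorem continuousOn_sub (hS : IsSemigroupGeneratedByNeg B S) (t : ℝ) (x : X) :
    ContinuousOn (fun s => S (t - s) x) (Iic t) :=
  (hS.continuousOn x).comp (by fun_prop) fun s hs => by simpa using hs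

theorem intervalIntegrable_apply (hS : IsSemigroupGeneratedByNeg B S) {t : ℝ} (ht : 0 ≤ t)
    {g : ℝ → X} (hg : IntervalIntegrable g volume 0 t) :
    IntervalIntegrable (fun s => S (t - s) (g s)) volume 0 t := by
  obtain ⟨K, hK0, hK⟩ := hS.exists_bound t
  rw [intervalIntegrable_iff_integrableOn_Ioc_of_le ht] at hg ⊢
  refine (hg.norm.const_mul K).mono' (aestronglyMeasurable_clm_apply (fun x => ?_)
    hg.aestronglyMeasurable) ?_
  · exact ((hS.continuousOn_sub t x).mono Ioc_subset_Iic_self).aestronglyMeasurable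
      measurableSet_Ioc
  · filter_upwards [ae_restrict_mem measurableSet_Ioc] with s hs
    exact ((S (t - s)).le_opNorm _).trans
      (by gcongr; exact hK _ ⟨by linarith [hs.2], by linarith [hs.1]⟩)

/-- Duhamel's formula for an absolutely continuous function `U` with derivative `g` and such that
`U = R h` a.e., where `R` is the inverse of the negative of the generator. -/
theorem duhamel (hS : IsSemigroupGeneratedByNeg B S) {R : X →L[ℂ] X} (hR : Function.Injective R)
    (hB : ∀ x y, (x, y) ∈ B ↔ R y = x) {t : ℝ} (ht : 0 ≤ t) {U g h : ℝ → X}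
    (hg : IntervalIntegrable g volume 0 t) (hh : IntervalIntegrable h volume 0 t)
    (hU : ∀ s ∈ Icc 0 t, U s = U 0 + ∫ r in (0 : ℝ)..s, g r)
    (hRh : ∀ᵐ s ∂(volume.restrict (Ioc 0 t)), R (h s) = U s) :
    U t = S t (U 0) + ∫ s in (0 : ℝ)..t, S (t - s) (g s + h s) := by
  have hcomm : ∀ s, 0 ≤ s → ∀ x, R (S s x) = S s (R x) := fun s hs x =>
    (hB _ _).1 (hS.mem_apply hs ((hB _ _).2 rfl))
  obtain ⟨K, hK0, hK⟩ := hS.exists_bound t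
  -- Composition with `R` lands in the domain of the generator, so `Ψ` is differentiable on every
  -- vector, with bounded derivative.
  have key := integral_clm_apply_by_parts (K := K) ht (Ψ := fun s => (S (t - s)).comp R)
    (Ψ' := fun s => S (t - s)) (g := g) (U := U)
    (fun x => ((hS.continuousOn_sub t x).mono Ioc_subset_Iic_self).aestronglyMeasurable
      measurableSet_Ioc)
    (fun s hs => hK _ ⟨by linarith [hs.2], by linarith [hs.1]⟩)
    (fun s hs x => by
      rw [intervalIntegral.integral_comp_sub_left (fun r => S r x) t, sub_self,
        hS.integral_apply ((hB (R x) x).2 rfl) (by linarith [hs.2])]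
      simp [hS.map_zero])
    (by rwa [intervalIntegrable_iff_integrableOn_Ioc_of_le ht] at hg) hU
  have i₁ := hS.intervalIntegrable_apply ht hg
  have i₂ := hS.intervalIntegrable_apply ht hh
  have hR_int : ∀ v : ℝ → X, IntervalIntegrable (fun s => S (t - s) (v s)) volume 0 t →
      R (∫ s in (0 : ℝ)..t, S (t - s) (v s)) = ∫ s in (0 : ℝ)..t, S (t - s) (R (v s)) := by
    intro v hv
    rw [← ContinuousLinearMap.intervalIntegral_comp_comm _ hv]
    refine intervalIntegral.integral_congr fun s hs => ?_
    rw [uIcc_of_le ht] at hs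
    exact hcomm _ (by linarith [hs.2]) _
  have hUh : ∫ s in (0 : ℝ)..t, S (t - s) (U s) = ∫ s in (0 : ℝ)..t, S (t - s) (R (h s)) := by
    rw [intervalIntegral.integral_of_le ht, intervalIntegral.integral_of_le ht]
    refine integral_congr_ae ?_
    filter_upwards [hRh] with s hs
    rw [hs]
  -- It suffices to compare images under `R`: there `R(h s)` becomes `U s`, the term left by the
  -- integration by parts.
  apply hR
  simp only [_root_.map_add]
  rw [intervalIntegral.integral_add i₁ i₂, _root_.map_add, hR_int _ i₁, hR_int _ i₂, ← hUh, hcomm t ht]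
  simp only [ContinuousLinearMap.comp_apply, sub_self, sub_zero, hS.map_zero,
    ContinuousLinearMap.id_apply] at key
  rw [key]
  abel

end IsSemigroupGeneratedByNeg

end Duhamel

/-! ### A Gronwall lemma for convolution kernels -/

section ConvolutionGronwall

open scoped ENNReal

/-- The weight tends to `0` at each point of the support of `k` and is at most one there; dominated
convergence. -/
theorem exists_weight_lintegral_le {k : ℝ → ℝ≥0∞} (hk : AEMeasurable k)
    (hki : ∫⁻ r, k r ≠ ⊤) (hk0 : ∀ r ≤ 0, k r = 0) {ε : ℝ≥0∞} (hε : 0 < ε) :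
    ∃ n : ℕ, ∫⁻ r, k r * ENNReal.ofReal (Real.exp (-(n * r))) ≤ ε := by
  have hfin := ae_lt_top' hk hki
  have hlim : Tendsto (fun n : ℕ => ∫⁻ r, k r * ENNReal.ofReal (Real.exp (-(n * r)))) atTop
      (𝓝 (∫⁻ _ : ℝ, 0)) := by
    refine tendsto_lintegral_of_dominated_convergence' k (fun n => ?_) (fun n => ?_) hki ?_
    · exact hk.mul (Measurable.aemeasurable (by fun_prop))
    · refine ae_of_all _ fun r => ?_
      rcases le_or_gt r 0 with h | h
      · simp [hk0 r h]
      · refine mul_le_of_le_one_right' ?_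
        rw [ENNReal.ofReal_le_one, Real.exp_le_one_iff]
        have : 0 ≤ (n : ℝ) * r := by positivity
        linarith
    · filter_upwards [hfin] with r hr
      rcases le_or_gt r 0 with h | h
      · simp [hk0 r h]
      · have h1 : Tendsto (fun n : ℕ => Real.exp (-(n * r))) atTop (𝓝 0) :=
          Real.tendsto_exp_neg_atTop_nhds_zero.comp
            (tendsto_natCast_atTop_atTop.atTop_mul_const h)
        have h2 := ENNReal.Tendsto.const_mul (a := k r) (ENNReal.tendsto_ofReal h1)
          (Or.inr hr.ne)
        simpa using h2
  rw [lintegral_zero] at hlim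
  exact (hlim.eventually_le_const hε).exists

/-- A nonnegative integrable function dominated by its convolution with an integrable kernel
supported on the positive half-line vanishes. -/
theorem ae_eq_zero_of_le_convolution {k h : ℝ → ℝ≥0∞} (hk : AEMeasurable k)
    (hki : ∫⁻ r, k r ≠ ⊤) (hk0 : ∀ r ≤ 0, k r = 0) (hh : AEMeasurable h)
    (hhi : ∫⁻ r, h r ≠ ⊤) (hh0 : ∀ r ≤ 0, h r = 0)
    (hle : ∀ᵐ t, h t ≤ ∫⁻ s, k (t - s) * h s) : h =ᵐ[volume] 0 := by
  obtain ⟨n, hn⟩ := exists_weight_lintegral_le hk hki hk0 (ε := 2⁻¹) (by simp)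
  let e : ℝ → ℝ≥0∞ := fun r => ENNReal.ofReal (Real.exp (-(n * r)))
  have he : Measurable e := by fun_prop
  have he_mul : ∀ s t : ℝ, e t = e (t - s) * e s := fun s t => by
    simp only [e]
    rw [← ENNReal.ofReal_mul (Real.exp_pos _).le, ← Real.exp_add]
    congr 2; ring
  have he1 : ∀ r, 0 < r → e r ≤ 1 := fun r hr => by
    simp only [e]
    rw [ENNReal.ofReal_le_one, Real.exp_le_one_iff]
    have : 0 ≤ (n : ℝ) * r := by positivity
    linarith
  have hepos : ∀ r, e r ≠ 0 := fun r => by simp [e, Real.exp_pos]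
  set I := ∫⁻ t, h t * e t with hI
  -- Finiteness is what allows concluding `I = 0` from `I ≤ I / 2`.
  have hIfin : I ≠ ⊤ := by
    refine ne_top_of_le_ne_top hhi (lintegral_mono fun t => ?_)
    rcases le_or_gt t 0 with ht | ht
    · simp [hh0 t ht]
    · exact mul_le_of_le_one_right' (he1 t ht)
  have hmeas : AEMeasurable (fun p : ℝ × ℝ => k (p.1 - p.2) * h p.2 * e p.1)
      (volume.prod volume) := by
    refine ((AEMeasurable.comp_quasiMeasurePreserving hk
      (quasiMeasurePreserving_sub_of_right_invariant volume volume)).mul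
      hh.comp_snd).mul (he.comp measurable_fst).aemeasurable
  have hle2 : I ≤ 2⁻¹ * I := by
    calc I ≤ ∫⁻ t, (∫⁻ s, k (t - s) * h s) * e t := by
          refine lintegral_mono_ae ?_
          filter_upwards [hle] with t ht
          gcongr
      _ = ∫⁻ t, ∫⁻ s, k (t - s) * h s * e t := by
          refine lintegral_congr fun t => (lintegral_mul_const' _ _ ENNReal.ofReal_ne_top).symm
      _ = ∫⁻ s, ∫⁻ t, k (t - s) * h s * e t := lintegral_lintegral_swap hmeas
      _ = ∫⁻ s, (h s * e s) * ∫⁻ t, k (t - s) * e (t - s) := by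
          refine lintegral_congr fun s => ?_
          rw [← lintegral_const_mul'' _ ?_]
          · refine lintegral_congr fun t => ?_
            rw [he_mul s t]; ring
          · exact (hk.mul he.aemeasurable).comp_quasiMeasurePreserving
              (measurePreserving_sub_right volume s).quasiMeasurePreserving
      _ = ∫⁻ s, (h s * e s) * ∫⁻ t, k t * e t := by
          refine lintegral_congr fun s => ?_
          rw [lintegral_sub_right_eq_self (fun t => k t * e t) s]
      _ = I * ∫⁻ t, k t * e t := lintegral_mul_const'' _ (hh.mul he.aemeasurable)
      _ ≤ I * 2⁻¹ := by gcongr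
      _ = 2⁻¹ * I := mul_comm _ _
  have hI0 : I = 0 := by
    by_contra hne
    have h1 : 2⁻¹ * I < I := by
      rw [mul_comm, ← div_eq_mul_inv]
      exact ENNReal.half_lt_self hne hIfin
    exact absurd hle2 (not_le.2 h1)
  rw [hI, lintegral_eq_zero_iff' (f := fun t => h t * e t) (hh.mul he.aemeasurable)] at hI0
  filter_upwards [hI0] with t ht
  exact (mul_eq_zero.1 ht).resolve_right (hepos t)

end ConvolutionGronwall

/-! ### Coercive forms and their semigroups -/

section Forms

variable {V H : Type*} [NormedAddCommGroup V] [InnerProductSpace ℂ V]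
  [NormedAddCommGroup H] [InnerProductSpace ℂ H]

variable {j : V →L[ℂ] H}
variable {A : V →L[ℂ] AntiDual V} {M δ : ℝ} {N : AntiDual V →L[ℂ] V}

theorem embV_apply_self (v : V) : embV j v v = ((‖j v‖ ^ 2 : ℝ) : ℂ) := by
  change inner ℂ (j v) (j v) = _
  rw [inner_self_eq_norm_sq_to_K]
  norm_cast

theorem embH_injective (hjd : DenseRange j) : Function.Injective (embH j) := by
  intro x y h
  have := hjd.equalizer (g := fun w : H => inner ℂ w x) (h := fun w : H => inner ℂ w y)
    (by fun_prop) (by fun_prop)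
    (funext fun v => congrArg (fun ℓ : AntiDual V => ℓ v) h)
  exact ext_inner_left ℂ fun v => congrFun this v

theorem embV_injective (hj : Function.Injective j) (hjd : DenseRange j) :
    Function.Injective (embV j) :=
  (embH_injective hjd).comp hj

theorem mem_opDual_iff (hAN : ∀ ℓ, A (N ℓ) = ℓ) (hNA : ∀ v, N (A v) = v) (x y : AntiDual V) :
    (x, y) ∈ opDual j A ↔ (embV j ∘L N) y = x := by
  rw [mem_opDual]
  constructor
  · rintro ⟨v, rfl, rfl⟩
    simp [hNA]
  · intro h
    exact ⟨N y, h, hAN y⟩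

theorem mem_opPart_iff (hjd : DenseRange j) (hAN : ∀ ℓ, A (N ℓ) = ℓ) (hNA : ∀ v, N (A v) = v)
    (x y : H) : (x, y) ∈ opPart j A ↔ (j ∘L N ∘L embH j) y = x := by
  change (embH j x, embH j y) ∈ opDual j A ↔ _
  rw [mem_opDual_iff hAN hNA]
  exact (embH_injective hjd).eq_iff (a := j (N (embH j y)))

variable [CompleteSpace V]

/-- The Riesz isomorphism between a Hilbert space and its antidual. -/
noncomputable def rieszAntiDual (V : Type*) [NormedAddCommGroup V] [InnerProductSpace ℂ V]
    [CompleteSpace V] : V ≃L[ℂ] AntiDual V :=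
  ContinuousLinearEquiv.ofBijective (innerSLFlip ℂ : V →L[ℂ] AntiDual V)
    (LinearMap.ker_eq_bot.2 fun x y h => ext_inner_left ℂ fun v =>
      congrArg (fun ℓ : AntiDual V => ℓ v) h)
    (LinearMap.range_eq_top.2 fun ℓ => by
      let m : StrongDual ℂ V := ((starL ℂ : ℂ ≃L⋆[ℂ] ℂ) : ℂ →L⋆[ℂ] ℂ).comp ℓ
      refine ⟨(InnerProductSpace.toDual ℂ V).symm m, ?_⟩
      ext v
      change inner ℂ v ((InnerProductSpace.toDual ℂ V).symm m) = ℓ v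
      rw [← inner_conj_symm, InnerProductSpace.toDual_symm_apply]
      simp [m])

theorem rieszAntiDual_apply (v w : V) : rieszAntiDual V v w = inner ℂ w v := rfl

theorem inner_rieszAntiDual_symm (ℓ : AntiDual V) (w : V) :
    inner ℂ w ((rieszAntiDual V).symm ℓ) = ℓ w := by
  rw [← rieszAntiDual_apply, ContinuousLinearEquiv.apply_symm_apply]

/-- The Lax-Milgram theorem. -/
theorem exists_inverse_of_coercive {B : V →L[ℂ] AntiDual V} {δ : ℝ} (hδ : 0 < δ)
    (hB : ∀ u, δ * ‖u‖ ^ 2 ≤ (B u u).re) :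
    ∃ N : AntiDual V →L[ℂ] V, (∀ ℓ, B (N ℓ) = ℓ) ∧ (∀ v, N (B v) = v) ∧ ‖N‖ ≤ δ⁻¹ := by
  let L : V →L[ℂ] V := ((rieszAntiDual V).symm : AntiDual V →L[ℂ] V).comp B
  have hL : ∀ v w, inner ℂ w (L v) = B v w := fun v w => inner_rieszAntiDual_symm _ _
  obtain ⟨u, hu⟩ := L.isUnit_of_forall_le_norm_inner_map (c := ⟨δ, hδ.le⟩) hδ fun x => by
    rw [norm_inner_symm, hL]
    change ‖x‖ ^ 2 * δ ≤ _
    rw [mul_comm]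
    exact (hB x).trans (Complex.re_le_norm _)
  have h1 : ∀ v, L ((↑u⁻¹ : V →L[ℂ] V) v) = v := fun v => by
    rw [← hu]
    exact congrArg (fun Φ : V →L[ℂ] V => Φ v) u.mul_inv
  have h2 : ∀ v, (↑u⁻¹ : V →L[ℂ] V) (L v) = v := fun v => by
    rw [← hu]
    exact congrArg (fun Φ : V →L[ℂ] V => Φ v) u.inv_mul
  let N : AntiDual V →L[ℂ] V := (↑u⁻¹ : V →L[ℂ] V).comp ((rieszAntiDual V).symm : AntiDual V →L[ℂ] V)
  have hN : ∀ ℓ, B (N ℓ) = ℓ := fun ℓ => (rieszAntiDual V).symm.injective (h1 _)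
  refine ⟨N, hN, h2, ContinuousLinearMap.opNorm_le_bound _ (inv_nonneg.2 hδ.le) fun ℓ => ?_⟩
  rw [inv_mul_eq_div, le_div_iff₀' hδ]
  rcases (norm_nonneg (N ℓ)).eq_or_lt with h0 | h0
  · rw [← h0]; simp
  · rw [← mul_le_mul_iff_left₀ h0]
    calc δ * ‖N ℓ‖ * ‖N ℓ‖ = δ * ‖N ℓ‖ ^ 2 := by ring
      _ ≤ ‖B (N ℓ) (N ℓ)‖ := (hB _).trans (Complex.re_le_norm _)
      _ ≤ ‖ℓ‖ * ‖N ℓ‖ := by rw [hN]; exact ℓ.le_opNorm _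

/-- The shift adds `Re z ‖j u‖² ≥ 0` to the real part of the form, so Lax-Milgram applies with the
same `δ` throughout the half-plane. -/
theorem exists_shifted_inverse (hδ : 0 < δ) (hA : ∀ u, δ * ‖u‖ ^ 2 ≤ (A u u).re) {z : ℂ}
    (hz : 0 ≤ z.re) : ∃ N : AntiDual V →L[ℂ] V, (∀ ℓ, z • embV j (N ℓ) + A (N ℓ) = ℓ) ∧
      (∀ v, N (z • embV j v + A v) = v) ∧ ‖N‖ ≤ δ⁻¹ := by
  refine exists_inverse_of_coercive (B := z • embV j + A) hδ fun u => ?_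
  have h1 : ((z • embV j + A) u u).re = z.re * ‖j u‖ ^ 2 + (A u u).re := by
    change (z * embV j u u + A u u).re = _
    rw [embV_apply_self, Complex.add_re, Complex.re_mul_ofReal]
  rw [h1]
  have := mul_nonneg hz (sq_nonneg ‖j u‖)
  linarith [hA u]

theorem isSectorialInverse_dual (hδ : 0 < δ) (hM : ‖A‖ ≤ M)
    (hA : ∀ u, δ * ‖u‖ ^ 2 ≤ (A u u).re) (hAN : ∀ ℓ, A (N ℓ) = ℓ) (hNA : ∀ v, N (A v) = v) :
    IsSectorialInverse (embV j ∘L N) (M / δ) := by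
  intro z hz
  obtain ⟨N', h1, h2, h3⟩ := exists_shifted_inverse (j := j) hδ hA hz
  -- The witness is `𝒜(z + 𝒜)⁻¹`, bounded directly by `‖A‖` and the Lax-Milgram constant.
  refine ⟨A ∘L N', ?_, ?_, ?_⟩
  · ext1 ℓ
    have : ℓ + z • embV j (N ℓ) = z • embV j (N ℓ) + A (N ℓ) := by rw [hAN, add_comm]
    change A (N' (ℓ + z • embV j (N ℓ))) = ℓ
    rw [this, h2, hAN]
  · ext1 ℓ
    change A (N' ℓ) + z • embV j (N (A (N' ℓ))) = ℓ
    rw [hNA, add_comm, h1]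
  · refine (ContinuousLinearMap.opNorm_comp_le _ _).trans ?_
    rw [div_eq_mul_inv]
    exact mul_le_mul hM h3 (norm_nonneg _) (A.opNorm_nonneg.trans hM)

theorem isSectorialInverse_part (hδ : 0 < δ) (hM : ‖A‖ ≤ M)
    (hA : ∀ u, δ * ‖u‖ ^ 2 ≤ (A u u).re) (hAN : ∀ ℓ, A (N ℓ) = ℓ) (hNA : ∀ v, N (A v) = v) :
    IsSectorialInverse (j ∘L N ∘L embH j) (2 + M / δ) := by
  have hM0 : 0 ≤ M := A.opNorm_nonneg.trans hM
  intro z hz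
  obtain ⟨N', h1, h2, -⟩ := exists_shifted_inverse (j := j) hδ hA hz
  -- In `H` the factor `A` is unbounded, so the same operator is written `1 - z(z + A)⁻¹`; testing
  -- the resolvent equation with `u` itself bounds `‖z‖ ‖j u‖` by `(1 + M/δ)‖x‖`.
  refine ⟨1 - z • (j ∘L N' ∘L embH j), ?_, ?_, ?_⟩
  · ext1 x
    have e1 : embH j (j (N (embH j x))) = embV j (N (embH j x)) := rfl
    have e2 : N' (embH j x + z • embV j (N (embH j x))) = N (embH j x) := by
      have := h2 (N (embH j x))
      rwa [hAN, add_comm] at this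
    change (x + z • j (N (embH j x))) - z • j (N' (embH j (x + z • j (N (embH j x))))) = x
    rw [map_add, map_smul, e1, e2]
    abel
  · ext1 x
    have e2 : N (embH j (x - z • j (N' (embH j x)))) = N' (embH j x) := by
      rw [map_sub, map_smul]
      change N (embH j x - z • embV j (N' (embH j x))) = _
      rw [← eq_sub_of_add_eq' (h1 (embH j x)), hNA]
    change (x - z • j (N' (embH j x))) + z • j (N (embH j (x - z • j (N' (embH j x))))) = x
    rw [e2]
    abel
  · refine ContinuousLinearMap.opNorm_le_bound _ (by positivity) fun x => ?_
    set u := N' (embH j x) with hu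
    have key : z * ((‖j u‖ ^ 2 : ℝ) : ℂ) + A u u = inner ℂ (j u) x := by
      have := congrArg (fun ℓ : AntiDual V => ℓ u) (h1 (embH j x))
      rw [← embV_apply_self]
      exact this
    have hin : ‖inner ℂ (j u) x‖ ≤ ‖j u‖ * ‖x‖ := norm_inner_le_norm _ _
    have hu2 : δ * ‖u‖ ^ 2 ≤ ‖j u‖ * ‖x‖ := by
      refine le_trans ?_ ((Complex.re_le_norm _).trans hin)
      rw [← key, Complex.add_re, Complex.re_mul_ofReal]
      have := mul_nonneg hz (sq_nonneg ‖j u‖)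
      linarith [hA u]
    have hAu : ‖A u u‖ ≤ M / δ * (‖j u‖ * ‖x‖) := by
      calc ‖A u u‖ ≤ ‖A u‖ * ‖u‖ := (A u).le_opNorm u
        _ ≤ M * ‖u‖ * ‖u‖ := by gcongr; exact A.le_of_opNorm_le hM u
        _ = M / δ * (δ * ‖u‖ ^ 2) := by field_simp
        _ ≤ _ := by gcongr
    have hzu : ‖z‖ * ‖j u‖ * ‖j u‖ ≤ (1 + M / δ) * ‖x‖ * ‖j u‖ := by
      calc ‖z‖ * ‖j u‖ * ‖j u‖ = ‖z * ((‖j u‖ ^ 2 : ℝ) : ℂ)‖ := by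
            rw [norm_mul, Complex.norm_real, Real.norm_of_nonneg (sq_nonneg _)]; ring
        _ = ‖inner ℂ (j u) x - A u u‖ := by rw [← key, add_sub_cancel_right]
        _ ≤ ‖j u‖ * ‖x‖ + M / δ * (‖j u‖ * ‖x‖) :=
            (norm_sub_le _ _).trans (add_le_add hin hAu)
        _ = _ := by ring
    have hzu' : ‖z‖ * ‖j u‖ ≤ (1 + M / δ) * ‖x‖ := by
      rcases (norm_nonneg (j u)).eq_or_lt with h0 | h0
      · rw [← h0, mul_zero]; positivity
      · exact le_of_mul_le_mul_right hzu h0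
    change ‖x - z • j u‖ ≤ _
    calc ‖x - z • j u‖ ≤ ‖x‖ + ‖z‖ * ‖j u‖ := by rw [← norm_smul]; exact norm_sub_le _ _
      _ ≤ ‖x‖ + (1 + M / δ) * ‖x‖ := by gcongr
      _ = (2 + M / δ) * ‖x‖ := by ring

variable [CompleteSpace H]

/-- Up to the Riesz isomorphism `embH j` is the adjoint of `j`, whose range is dense because `j` is
injective. -/
theorem denseRange_embH (hj : Function.Injective j) : DenseRange (embH j) := by
  have hadj : DenseRange (ContinuousLinearMap.adjoint j) := by
    have h : (LinearMap.range (ContinuousLinearMap.adjoint j).toLinearMap)ᗮ = ⊥ := by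
      rw [Submodule.eq_bot_iff]
      intro v hv
      rw [Submodule.mem_orthogonal] at hv
      refine hj ((ext_inner_left ℂ fun w => ?_).trans (map_zero j).symm)
      rw [inner_zero_right, ← ContinuousLinearMap.adjoint_inner_left]
      exact hv _ ⟨w, rfl⟩
    rw [← Submodule.topologicalClosure_eq_top_iff, ← Submodule.dense_iff_topologicalClosure_eq_top]
      at h
    exact h
  have e : ⇑(embH j) = rieszAntiDual V ∘ ContinuousLinearMap.adjoint j := by
    funext x
    ext v
    change inner ℂ (j v) x = inner ℂ v (ContinuousLinearMap.adjoint j x)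
    rw [ContinuousLinearMap.adjoint_inner_right]
  rw [e]
  exact (rieszAntiDual V).surjective.denseRange.comp hadj (rieszAntiDual V).continuous

theorem denseRange_embV (hj : Function.Injective j) (hjd : DenseRange j) :
    DenseRange (embV j) :=
  (denseRange_embH hj).comp hjd (embH j).continuous

/-- The semigroups associated with a coercive form on `V'` and on `H` exist and agree on `H`, and
the one on `V'` maps into `V` with the estimate for analytic semigroups. -/
theorem semigroups_of_coercive (hj : Function.Injective j) (hjd : DenseRange j) (hδ : 0 < δ)
    (hM : ‖A‖ ≤ M) (hA : ∀ u, δ * ‖u‖ ^ 2 ≤ (A u u).re) :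
    IsSemigroupGeneratedByNeg (opPart j A) (expNeg (opPart j A)) ∧
    IsSemigroupGeneratedByNeg (opDual j A) (expNeg (opDual j A)) ∧
    (∀ t, 0 ≤ t → ∀ x, embH j (expNeg (opPart j A) t x) = expNeg (opDual j A) t (embH j x)) ∧
    ∃ P : ℝ → AntiDual V →L[ℂ] V,
      (∀ t, 0 < t → ∀ x, embV j (P t x) = expNeg (opDual j A) t x) ∧
      (∀ t, 0 < t → ‖P t‖ ≤ δ⁻¹ * sectorialBound (M / δ) / t) ∧
      ∀ x, StronglyMeasurable fun t => P t x := by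
  obtain ⟨N, hAN, hNA, hN⟩ := exists_inverse_of_coercive hδ hA
  have hNs : Function.Surjective N := fun v => ⟨A v, hNA v⟩
  have hRd : DenseRange (embV j ∘L N) :=
    (denseRange_embV hj hjd).comp hNs.denseRange (embV j).continuous
  have hRp : DenseRange (j ∘L N ∘L embH j) :=
    hjd.comp (hNs.denseRange.comp (denseRange_embH hj) N.continuous) j.continuous
  have hBd := mem_opDual_iff (j := j) hAN hNA
  have hBp := mem_opPart_iff hjd hAN hNA
  obtain ⟨S, Q, hS, -, hQ, hQK, hQm⟩ :=
    (isSectorialInverse_dual (j := j) hδ hM hA hAN hNA).exists_semigroup hRd hBd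
  obtain ⟨S', -, hS', -⟩ :=
    (isSectorialInverse_part (j := j) hδ hM hA hAN hNA).exists_semigroup hRp hBp
  have hgd := expNeg_spec ⟨S, hS⟩
  have hgp := expNeg_spec ⟨S', hS'⟩
  have hdd : Dense {x | ∃ y, (x, y) ∈ opDual j A} :=
    hRd.mono (by rintro _ ⟨y, rfl⟩; exact ⟨y, (hBd _ _).2 rfl⟩)
  have hdp : Dense {x | ∃ y, (x, y) ∈ opPart j A} :=
    hRp.mono (by rintro _ ⟨y, rfl⟩; exact ⟨y, (hBp _ _).2 rfl⟩)
  -- `Q t` is `𝒜 e^{-t𝒜}`, of size `1/t` on `V'`; composing with `N = 𝒜⁻¹`, bounded from `V'` to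
  -- `V`, turns this into the smoothing estimate.
  refine ⟨hgp, hgd, fun t ht x => hgp.intertwine hgd (embH j) (fun _ _ h => h) hdp ht x,
    fun t => N ∘L Q t, fun t ht x => ?_, fun t ht => ?_, fun x => ?_⟩
  · rw [hgd.unique hS hdd ht.le]
    exact hQ t ht x
  · refine (ContinuousLinearMap.opNorm_comp_le _ _).trans ?_
    rw [mul_div_assoc]
    exact mul_le_mul hN (hQK t ht) (norm_nonneg _) (inv_nonneg.2 hδ.le)
  · exact N.continuous.comp_stronglyMeasurable (hQm x)

end Forms

/-! ### Estimates for the non-autonomous formula -/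

section NonAutonomous

/-- The integral is known only in the larger space. If the right side is infinite there is nothing
to prove; otherwise the Bochner integral exists in `V`, and injectivity of `E` identifies it with
`d`. -/
theorem enorm_le_lintegral_of_map_eq_integral {α V W : Type*} [MeasurableSpace α] {μ : Measure α}
    [NormedAddCommGroup V] [NormedSpace ℂ V] [CompleteSpace V] [NormedAddCommGroup W]
    [NormedSpace ℂ W] [CompleteSpace W] {E : V →L[ℂ] W} (hE : Function.Injective E) {F : α → V}
    (hF : AEStronglyMeasurable F μ) {d : V} (hd : E d = ∫ a, E (F a) ∂μ) :
    ‖d‖ₑ ≤ ∫⁻ a, ‖F a‖ₑ ∂μ := by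
  by_cases hfin : ∫⁻ a, ‖F a‖ₑ ∂μ = ⊤
  · rw [hfin]; exact le_top
  · have hi : Integrable F μ := ⟨hF, lt_top_iff_ne_top.2 hfin⟩
    rw [ContinuousLinearMap.integral_comp_comm _ hi] at hd
    rw [hE hd]
    exact enorm_integral_le_lintegral_enorm F

variable {V H : Type*} [NormedAddCommGroup V] [InnerProductSpace ℂ V]
  [NormedAddCommGroup H] [InnerProductSpace ℂ H] {j : V →L[ℂ] H} {T M δ : ℝ}
  {A : ℝ → V →L[ℂ] AntiDual V}

theorem norm_form_le (hbdd : ∀ t ∈ Icc 0 T, ∀ u v : V, ‖A t u v‖ ≤ M * ‖u‖ * ‖v‖) :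
    ∀ t ∈ Icc 0 T, ‖A t‖ ≤ |M| := fun t ht =>
  ContinuousLinearMap.opNorm_le_bound _ (abs_nonneg M) fun u =>
    ContinuousLinearMap.opNorm_le_bound _ (by positivity) fun v => (hbdd t ht u v).trans
      (by gcongr; exact le_abs_self M)

theorem integrableOn_form_apply {K : ℝ} (hK : ∀ t ∈ Icc 0 T, ‖A t‖ ≤ K)
    (hm : ∀ u, AEStronglyMeasurable (fun t => A t u) (volume.restrict (Icc 0 T))) {u : ℝ → V}
    (hu : IntegrableOn u (Icc 0 T)) : IntegrableOn (fun s => A s (u s)) (Icc 0 T) := by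
  refine (hu.norm.const_mul K).mono' (aestronglyMeasurable_clm_apply hm hu.aestronglyMeasurable) ?_
  filter_upwards [ae_restrict_mem measurableSet_Icc] with s hs
  exact (A s).le_of_opNorm_le (hK s hs) _

theorem intervalIntegrable_of_integrableOn_Icc {X : Type*} [NormedAddCommGroup X] {g : ℝ → X}
    (hg : IntegrableOn g (Icc 0 T)) {t : ℝ} (ht : t ∈ Icc 0 T) :
    IntervalIntegrable g volume 0 t := by
  rw [intervalIntegrable_iff_integrableOn_Ioc_of_le ht.1]
  exact hg.mono_set (Ioc_subset_Icc_self.trans (Icc_subset_Icc_right ht.2))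

theorem MemL2.integrableOn_Icc {X : Type*} [NormedAddCommGroup X] {g : ℝ → X} (hg : MemL2 T g) :
    IntegrableOn g (Icc 0 T) := by
  rw [integrableOn_Icc_iff_integrableOn_Ioo]
  exact hg.integrableOn

variable [CompleteSpace V]

/-- The Riesz isomorphism transports scalar measurability of the form to `V`, where Pettis's theorem
applies. -/
theorem aestronglyMeasurable_form [TopologicalSpace.SeparableSpace V]
    (hmeas : ∀ u v : V, AEMeasurable (fun t => A t u v) (volume.restrict (Icc 0 T))) (u : V) :
    AEStronglyMeasurable (fun t => A t u) (volume.restrict (Icc 0 T)) := by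
  have h : AEStronglyMeasurable (fun t => (rieszAntiDual V).symm (A t u))
      (volume.restrict (Icc 0 T)) := by
    refine aestronglyMeasurable_of_inner fun w => ?_
    simp only [inner_rieszAntiDual_symm]
    exact hmeas u w
  simpa using (rieszAntiDual V).continuous.comp_aestronglyMeasurable h

/-- The difference of two solutions of the representation formula satisfies a homogeneous
convolution inequality. -/
theorem enorm_le_convolution {S : ℝ → AntiDual V →L[ℂ] AntiDual V} {P : ℝ → AntiDual V →L[ℂ] V}
    (hE : Function.Injective (embV j)) {K t : ℝ}
    (hP : ∀ r, 0 < r → ∀ x, embV j (P r x) = S r x) (hPK : ∀ r, 0 < r → ‖P r‖ ≤ K / r)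
    (hPm : ∀ x, StronglyMeasurable fun r => P r x) (ht : t ∈ Ioo 0 T) {q : ℝ → AntiDual V}
    (hq : IntervalIntegrable q volume 0 t) {w : ℝ → ℝ} {h : ℝ → V}
    (hw0 : ∀ r ∈ Ioo 0 T, 0 ≤ w r) (hw : ∀ s ∈ Ioo 0 t, ‖q s‖ ≤ w (t - s) * ‖h s‖) {d : V}
    (hd : embV j d = ∫ s in (0 : ℝ)..t, S (t - s) (q s)) :
    ‖d‖ₑ ≤ ∫⁻ s, (Ioo 0 T).indicator (fun r => ENNReal.ofReal (K * (w r / r))) (t - s) *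
      (Ioo 0 T).indicator (fun s => ‖h s‖ₑ) s := by
  rw [intervalIntegrable_iff_integrableOn_Ioo_of_le ht.1.le] at hq
  rw [intervalIntegral.integral_of_le ht.1.le, integral_Ioc_eq_integral_Ioo] at hd
  have hd' : embV j d = ∫ s in Ioo 0 t, embV j (P (t - s) (q s)) := by
    rw [hd]
    refine setIntegral_congr_fun measurableSet_Ioo fun s hs => ?_
    exact (hP _ (sub_pos.2 hs.2) _).symm
  have hm : AEStronglyMeasurable (fun s => P (t - s) (q s)) (volume.restrict (Ioo 0 t)) := by
    refine aestronglyMeasurable_clm_apply (fun x => ?_) hq.aestronglyMeasurable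
    exact ((hPm x).comp_measurable (measurable_const.sub measurable_id)).aestronglyMeasurable
  refine (enorm_le_lintegral_of_map_eq_integral hE hm hd').trans ?_
  rw [← lintegral_indicator measurableSet_Ioo]
  refine lintegral_mono fun s => ?_
  by_cases hs : s ∈ Ioo 0 t
  · have hts : 0 < t - s := sub_pos.2 hs.2
    have h1 : t - s ∈ Ioo 0 T := ⟨hts, by linarith [hs.1, ht.2]⟩
    have h2 : s ∈ Ioo 0 T := ⟨hs.1, hs.2.trans ht.2⟩
    rw [indicator_of_mem hs, indicator_of_mem h1, indicator_of_mem h2, ← ofReal_norm,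
      ← ofReal_norm]
    have hK0 : 0 ≤ K / (t - s) := (P _).opNorm_nonneg.trans (hPK _ hts)
    have h3 : K * (w (t - s) / (t - s)) = K / (t - s) * w (t - s) := by ring
    rw [← ENNReal.ofReal_mul (h3 ▸ mul_nonneg hK0 (hw0 _ h1)), h3, mul_assoc]
    refine ENNReal.ofReal_le_ofReal (((P (t - s)).le_of_opNorm_le (hPK _ hts) _).trans ?_)
    gcongr
    exact hw s hs
  · rw [indicator_of_notMem hs]
    exact zero_le

end NonAutonomous

end NonAutonomousForms


/-! ### The representation formula and its uniqueness -/

theorem proposition3p3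
    {V H : Type*}
    [NormedAddCommGroup V] [InnerProductSpace ℂ V] [CompleteSpace V]
    [TopologicalSpace.SeparableSpace V]
    [NormedAddCommGroup H] [InnerProductSpace ℂ H] [CompleteSpace H]
    [TopologicalSpace.SeparableSpace H]
    -- the continuous and dense embedding of `V` into `H`
    (j : V →L[ℂ] H) (hj : Function.Injective j) (hjd : DenseRange j)
    (T : ℝ) (hT : 0 < T)
    -- the form `𝔞(t; u, v) = A t u v`, equivalently `t ↦ 𝒜(t) ∈ L(V, V')`
    (A : ℝ → V →L[ℂ] AntiDual V) (M δ : ℝ) (hδ : 0 < δ)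
    (hbdd : ∀ t ∈ Icc 0 T, ∀ u v : V, ‖A t u v‖ ≤ M * ‖u‖ * ‖v‖)
    (hcoer : ∀ t ∈ Icc 0 T, ∀ u : V, δ * ‖u‖ ^ 2 ≤ (A t u u).re)
    (hmeas : ∀ u v : V, AEMeasurable (fun t => A t u v) (volume.restrict (Icc 0 T)))
    (f : ℝ → AntiDual V) (hf : MemL2 T f) (u₀ : H) :
    -- the semigroups in the formula exist
    (∀ t ∈ Icc 0 T,
      IsSemigroupGeneratedByNeg (opPart j (A t)) (expNeg (opPart j (A t))) ∧
      IsSemigroupGeneratedByNeg (opDual j (A t)) (expNeg (opDual j (A t)))) ∧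
    -- the integrals in the formula exist
    (∀ u : ℝ → V, MemMR j T u → ∀ t ∈ Icc 0 T,
      IntervalIntegrable (fun s => expNeg (opDual j (A t)) (t - s) (f s)) volume 0 t ∧
      IntervalIntegrable (fun s => expNeg (opDual j (A t)) (t - s) ((A t - A s) (u s)))
        volume 0 t) ∧
    -- the solution satisfies the formula
    (∀ u : ℝ → V, IsSolution j T A f u₀ u → SatisfiesFormula j T A f u₀ u) ∧
    -- uniqueness in the Dini-continuous case
    (IsDiniContinuous T A →
      ∀ u₁ u₂ : ℝ → V, MemMR j T u₁ → MemMR j T u₂ →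
        SatisfiesFormula j T A f u₀ u₁ → SatisfiesFormula j T A f u₀ u₂ →
        ∀ᵐ t ∂(volume.restrict (Ioo 0 T)), u₁ t = u₂ t) := by
  have hM := norm_form_le hbdd
  have hsg := fun t (ht : t ∈ Icc 0 T) => semigroups_of_coercive hj hjd hδ (hM t ht) (hcoer t ht)
  have hE := embV_injective hj hjd
  have hAm := aestronglyMeasurable_form hmeas
  have hfi := hf.integrableOn_Icc
  have hdiff : ∀ u : ℝ → V, MemL2 T u → ∀ t ∈ Icc 0 T,
      IntegrableOn (fun s => (A t - A s) (u s)) (Icc 0 T) := fun u hu t ht =>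
    ((A t).integrable_comp hu.integrableOn_Icc).sub
      (integrableOn_form_apply hM hAm hu.integrableOn_Icc)
  have hint : ∀ u : ℝ → V, MemMR j T u → ∀ t ∈ Icc 0 T,
      IntervalIntegrable (fun s => expNeg (opDual j (A t)) (t - s) (f s)) volume 0 t ∧
      IntervalIntegrable (fun s => expNeg (opDual j (A t)) (t - s) ((A t - A s) (u s)))
        volume 0 t := fun u hu t ht =>
    ⟨(hsg t ht).2.1.intervalIntegrable_apply ht.1 (intervalIntegrable_of_integrableOn_Icc hfi ht),
      (hsg t ht).2.1.intervalIntegrable_apply ht.1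
        (intervalIntegrable_of_integrableOn_Icc (hdiff u hu.1 t ht) ht)⟩
  refine ⟨fun t ht => ⟨(hsg t ht).1, (hsg t ht).2.1⟩, hint, ?_, ?_⟩
  · rintro u ⟨hu, ⟨u', hu', hweak, hode⟩, U, hU, hU0⟩
    refine ⟨U, hU, fun t ht => ?_⟩
    obtain ⟨-, hS, hHV, -⟩ := hsg t ht
    obtain ⟨N, hAN, hNA, -⟩ := exists_inverse_of_coercive hδ (hcoer t ht)
    have hUi := hU.eq_add_integral hT hweak hu.2.1.integrableOn hu'.integrableOn
    have hsub : Ioc 0 t ⊆ Ioc 0 T := Ioc_subset_Ioc_right ht.2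
    have hae : ∀ {p : ℝ → Prop}, (∀ᵐ s ∂(volume.restrict (Ioo 0 T)), p s) →
        ∀ᵐ s ∂(volume.restrict (Ioc 0 t)), p s := fun h => by
      rw [restrict_Ioo_eq_restrict_Ioc] at h
      exact ae_mono (Measure.restrict_mono hsub le_rfl) h
    -- The operator is frozen at the endpoint `t`: `h s = 𝒜(t)u(s)`, whose image under `R` is
    -- `u(s)`.
    have hduh := hS.duhamel (R := embV j ∘L N)
      (hE.comp (Function.LeftInverse.injective hAN)) (mem_opDual_iff hAN hNA) ht.1
      (intervalIntegrable_of_integrableOn_Icc hu'.integrableOn_Icc ht)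
      (intervalIntegrable_of_integrableOn_Icc ((A t).integrable_comp hu.1.integrableOn_Icc) ht)
      (fun s hs => hUi s ⟨hs.1, hs.2.trans ht.2⟩)
      (by
        filter_upwards [hae hU.2] with s hs
        rw [hs]
        exact congrArg (embV j) (hNA (u s)))
    rw [hduh, hU0, hHV t ht.1, add_assoc,
      ← intervalIntegral.integral_add (hint u hu t ht).1 (hint u hu t ht).2]
    congr 1
    rw [intervalIntegral.integral_of_le ht.1, intervalIntegral.integral_of_le ht.1]
    refine integral_congr_ae ?_
    -- Here `u' + 𝒜(t)u = f + (𝒜(t) - 𝒜(s))u`, by the equation at time `s`.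
    filter_upwards [hae hode] with s hs
    rw [← map_add, ← hs, sub_apply]
    congr 1
    abel
  · rintro ⟨w, -, hw, hwi⟩ u₁ u₂ hu₁ hu₂ ⟨U₁, hU₁, hF₁⟩ ⟨U₂, hU₂, hF₂⟩
    have hw0 : ∀ r ∈ Ioo 0 T, 0 ≤ w r := fun r hr => by
      have := hw r ⟨hr.1.le, hr.2.le⟩ 0 ⟨le_rfl, hT.le⟩
      rw [sub_zero, abs_of_pos hr.1] at this
      exact (A r - A 0).opNorm_nonneg.trans this
    -- One constant serves all `t`, since it involves only the form bounds.
    set K : ℝ := δ⁻¹ * sectorialBound (|M| / δ)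
    have hdi : IntegrableOn (fun t => u₁ t - u₂ t) (Ioo 0 T) :=
      hu₁.1.integrableOn.sub hu₂.1.integrableOn
    have hki : IntegrableOn (fun r => K * (w r / r)) (Ioo 0 T) := hwi.const_mul K
    have hzero := ae_eq_zero_of_le_convolution
      (k := (Ioo 0 T).indicator fun r => ENNReal.ofReal (K * (w r / r)))
      (h := (Ioo 0 T).indicator fun s => ‖u₁ s - u₂ s‖ₑ)
      ((aemeasurable_indicator_iff measurableSet_Ioo).2
        hki.aestronglyMeasurable.aemeasurable.ennreal_ofReal)
      (by
        rw [lintegral_indicator measurableSet_Ioo]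
        exact hki.lintegral_lt_top.ne)
      (fun r hr => indicator_of_notMem (fun h => absurd h.1 (not_lt.2 hr)) _)
      ((aemeasurable_indicator_iff measurableSet_Ioo).2 hdi.aestronglyMeasurable.enorm)
      (by
        rw [lintegral_indicator measurableSet_Ioo]
        exact hdi.hasFiniteIntegral.ne)
      (fun r hr => indicator_of_notMem (fun h => absurd h.1 (not_lt.2 hr)) _)
      (by
        filter_upwards [(ae_restrict_iff' measurableSet_Ioo).1 hU₁.2,
          (ae_restrict_iff' measurableSet_Ioo).1 hU₂.2] with t h₁ h₂
        by_cases ht : t ∈ Ioo 0 T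
        · have htc := Ioo_subset_Icc_self ht
          obtain ⟨-, hS, -, P, hP, hPK, hPm⟩ := hsg t htc
          have hd : IntegrableOn (fun s => (A t - A s) (u₁ s - u₂ s)) (Icc 0 T) := by
            simpa only [map_sub] using! (hdiff u₁ hu₁.1 t htc).sub (hdiff u₂ hu₂.1 t htc)
          rw [indicator_of_mem ht]
          refine enorm_le_convolution hE hP hPK hPm ht (h := fun s => u₁ s - u₂ s)
            (intervalIntegrable_of_integrableOn_Icc hd htc) hw0 (fun s hs => ?_) ?_
          · refine (A t - A s).le_of_opNorm_le ?_ _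
            have := hw t htc s ⟨hs.1.le, (hs.2.trans ht.2).le⟩
            rwa [abs_of_pos (sub_pos.2 hs.2)] at this
          -- The terms with `u₀` and `f` cancel in the difference of the two formulas.
          · rw [map_sub, ← h₁ ht, ← h₂ ht, hF₁ t htc, hF₂ t htc, add_sub_add_left_eq_sub,
              ← intervalIntegral.integral_sub (hint u₁ hu₁ t htc).2 (hint u₂ hu₂ t htc).2]
            simp only [map_sub]
        · rw [indicator_of_notMem ht]
          exact zero_le)
    rw [ae_restrict_iff' measurableSet_Ioo]
    filter_upwards [hzero] with t h0 ht
    rw [indicator_of_mem ht, Pi.zero_apply, enorm_eq_zero, sub_eq_zero] at h0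
    exact h0
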